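/- **Theorem.** Let $\mathbb{F}$ be a field, let $\mathbf{vec}$ be the category of finite-dimensional $\mathbb{F}$-vector spaces, and give $\mathbb{Z}^2$ the componentwise partial order. Posets are regarded as categories. An *interval* of a poset is a nonempty, convex subset $J$ that is connected (any two points of $J$ are joined by a finite sequence of points of $J$ whose consecutive members are comparable). The interval module $\mathbb{I}_J$ is $\mathbb{F}$ at the points of $J$ and $0$ elsewhere, with identity maps between points of $J$ and zero maps otherwise. Let $I$ be a finite interval of $\mathbb{Z}^2$ and let $M : I \to \mathbf{vec}$ be a functor. Let $p_0,\dots,p_k$ be the minimal elements and $q_0,\dots,q_\ell$ the maximal elements of $I$, each listed in increasing order of the $x$-coordinate. The *boundary cap* of $I$ is the sequence $$\partial I:\quad p_k < (p_k\vee p_{k-1}) > p_{k-1} < \cdots > p_0 \;\le\; q_0 > (q_0\wedge q_1) < q_1 > \cdots < q_\ell ,$$ all of whose points lie in $I$. Let $\mathbf{ZZ}_{\partial I}$ be the zigzag poset $\bullet_1<\bullet_2>\bullet_3<\cdots>\bullet_{2k+1}<\circ_1>\circ_2<\cdots<\circ_{2\ell+1}$ with only these relations (and reflexivity), let $\iota_I:\mathbf{ZZ}_{\partial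 I}\to I$ be the order-preserving map sending its points in order to the terms of $\partial I$, and let $M_{\partial I}:=M\circ\iota_I$. Let $\mathrm{rank}(M)$ be the generalized rank of $M$, that is, the rank of the canonical map $\psi_M = i_p\circ\pi_p:\varprojlim M\to\varinjlim M$, where $\pi_p:\varprojlim M\to M_p$ and $i_p:M_p\to\varinjlim M$ are the structure maps and $p\in I$ is any point (the map does not depend on $p$). Then $M_{\partial I}$ has a barcode, i.e. it is isomorphic to a direct sum of finitely many interval modules $\mathbb{I}_{J_1}\oplus\cdots\oplus\mathbb{I}_{J_n}$ with $J_1,\dots,J_n$ intervals of $\mathbf{ZZ}_{\partial I}$; and for every such decomposition $\mathrm{rank}(M)$ equals the number of indices $j$ with $J_j=\mathbf{ZZ}_{\partial I}$, that is, the multiplicity of the full interval in the barcode of $M_{\partial I}$. -/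

import Mathlib

open CategoryTheory CategoryTheory.Limits

universe u

namespace ZigzagRank

/-! ### Finite intervals of a poset, persistence modules and barcodes -/

/-- A finite interval of a poset: a finite subset that is nonempty, convex and connected (any two
of its points are joined by a sequence of points of the subset, consecutive ones comparable). -/
@[ext]
structure FinInterval (P : Type*) [PartialOrder P] where
  carrier : Finset P
  nonempty : carrier.Nonempty
  convex : ∀ ⦃p q r : P⦄, p ∈ carrier → q ∈ carrier → p ≤ r → r ≤ q → r ∈ carrier
  connected : ∀ ⦃p q : P⦄, p ∈ carrier → q ∈ carrier →
    Relation.ReflTransGen (fun a b => a ∈ carrier ∧ b ∈ carrier ∧ (a ≤ b ∨ b ≤ a)) p q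

/-- The interval module of `J`. The space at `p` is the space of functions from the type
`PLift (p ∈ J)` (one point if `p ∈ J`, empty otherwise) to the field, that is, the field if `p ∈ J` and the zero space otherwise. The map from `p`
to `q` is the identity of the field if both points are in `J`, and zero otherwise. -/
noncomputable def intervalModule (𝔽 : Type u) [Field 𝔽] {P : Type} [PartialOrder P]
    (J : FinInterval P) : P ⥤ FGModuleCat.{u} 𝔽 := by
  classical exact
  { obj := fun p => FGModuleCat.of 𝔽 (PLift (p ∈ J.carrier) → 𝔽)
    map := fun {p q} _ => FGModuleCat.ofHom
      { toFun := fun v _ => if hp : p ∈ J.carrier then v ⟨hp⟩ else 0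
        map_add' := by
          intro v w
          funext hq
          by_cases hp : p ∈ J.carrier <;> simp [hp]
        map_smul' := by
          intro c v
          funext hq
          by_cases hp : p ∈ J.carrier <;> simp [hp] }
    map_id := by
      intro p
      apply FGModuleCat.hom_ext
      apply LinearMap.ext
      intro v
      funext hp
      exact dif_pos hp.down
    map_comp := by
      intro p q r f g
      apply FGModuleCat.hom_ext
      apply LinearMap.ext
      intro v
      funext hr
      change (if hp : p ∈ J.carrier then v ⟨hp⟩ else 0) =
        if hq : q ∈ J.carrier then (if hp : p ∈ J.carrier then v ⟨hp⟩ else 0) else 0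
      by_cases hp : p ∈ J.carrier
      · have hq : q ∈ J.carrier := J.convex hp hr.down (leOfHom f) (leOfHom g)
        rw [dif_pos hq]
      · simp [hp] }

/-- The (pointwise) direct sum of a finite family of persistence modules. -/
noncomputable def directSum {𝔽 : Type u} [Field 𝔽] {P : Type} [PartialOrder P] {n : ℕ}
    (N : Fin n → (P ⥤ FGModuleCat.{u} 𝔽)) : P ⥤ FGModuleCat.{u} 𝔽 where
  obj p := FGModuleCat.of 𝔽 (∀ i, (N i).obj p)
  map f := FGModuleCat.ofHom (LinearMap.pi fun i => ((N i).map f).hom.hom ∘ₗ LinearMap.proj i)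
  map_id p := by
    apply FGModuleCat.hom_ext
    apply LinearMap.ext
    intro v
    funext i
    change ((N i).map (𝟙 p)).hom.hom (v i) = v i
    rw [(N i).map_id]
    rfl
  map_comp f g := by
    apply FGModuleCat.hom_ext
    apply LinearMap.ext
    intro v
    funext i
    change ((N i).map (f ≫ g)).hom.hom (v i) = ((N i).map g).hom.hom (((N i).map f).hom.hom (v i))
    rw [(N i).map_comp]
    rfl

/-- `B` is a barcode of the module `M` over a finite poset: `M` is isomorphic to a direct sum of
interval modules and `B` is the multiset of the intervals that occur. (As the poset is finite, all
its intervals are finite; as the spaces `M p` are finite dimensional and intervals are nonempty,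
there can only be finitely many summands.) -/
def IsBarcode {𝔽 : Type u} [Field 𝔽] {P : Type} [PartialOrder P] [Finite P]
    (M : P ⥤ FGModuleCat.{u} 𝔽) (B : Multiset (FinInterval P)) : Prop :=
  ∃ (n : ℕ) (J : Fin n → FinInterval P),
    B = Finset.univ.val.map J ∧ Nonempty (M ≅ directSum fun i => intervalModule 𝔽 (J i))

/-- The multiplicity of the full interval (the one consisting of all points of `P`) in `B`. -/
def fullMultiplicity {P : Type} [PartialOrder P] [Fintype P] [DecidableEq P]
    (B : Multiset (FinInterval P)) : ℕ :=
  B.countP fun J => J.carrier = Finset.univ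

/-! ### The generalized rank -/

/-- The canonical limit-to-colimit map of `M`, computed through the point `p`: the projection of
the limit to `M p` followed by the map of `M p` to the colimit. -/
noncomputable def limToColim {𝔽 : Type u} [Field 𝔽] {P : Type} [PartialOrder P] [Fintype P]
    (M : P ⥤ FGModuleCat.{u} 𝔽) (p : P) : limit M ⟶ colimit M :=
  limit.π M p ≫ colimit.ι M p

/-- The limit-to-colimit map takes the same value at points joined by a chain of comparabilities,
so it does not depend on the point if the poset is connected. -/
theorem limToColim_eq {𝔽 : Type u} [Field 𝔽] {P : Type} [PartialOrder P] [Fintype P]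
    (M : P ⥤ FGModuleCat.{u} 𝔽) {p q : P}
    (h : Relation.ReflTransGen (fun a b : P => a ≤ b ∨ b ≤ a) p q) :
    limToColim M p = limToColim M q := by
  have key : ∀ {a b : P}, a ≤ b → limToColim M a = limToColim M b := by
    intro a b hab
    unfold limToColim
    rw [← limit.w M (homOfLE hab), ← colimit.w M (homOfLE hab), Category.assoc]
  induction h with
  | refl => rfl
  | tail _ hbc ih => exact ih.trans (hbc.elim key fun h => (key h).symm)

/-- The generalized rank of `M`: the rank of the canonical limit-to-colimit map, the latter
computed through the point `p`. -/
noncomputable def generalizedRank {𝔽 : Type u} [Field 𝔽] {P : Type} [PartialOrder P] [Fintype P]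
    (M : P ⥤ FGModuleCat.{u} 𝔽) (p : P) : ℕ :=
  Module.finrank 𝔽 (LinearMap.range (limToColim M p).hom.hom)

/-! ### Minimal and maximal points of a finite interval of the plane grid -/

open Classical in
/-- The minimal elements. The order on `ℤ × ℤ` is the componentwise one. -/
noncomputable def minElems (I : Finset (ℤ × ℤ)) : Finset (ℤ × ℤ) := {p ∈ I | ∀ q ∈ I, ¬ q < p}

open Classical in
/-- The maximal elements. -/
noncomputable def maxElems (I : Finset (ℤ × ℤ)) : Finset (ℤ × ℤ) := {p ∈ I | ∀ q ∈ I, ¬ p < q}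

theorem mem_minElems {I : Finset (ℤ × ℤ)} {p : ℤ × ℤ} :
    p ∈ minElems I ↔ p ∈ I ∧ ∀ q ∈ I, ¬ q < p := by
  classical exact Finset.mem_filter

theorem mem_maxElems {I : Finset (ℤ × ℤ)} {p : ℤ × ℤ} :
    p ∈ maxElems I ↔ p ∈ I ∧ ∀ q ∈ I, ¬ p < q := by
  classical exact Finset.mem_filter

/-- The elements of a finite set of `n` points in ascending lexicographic order. For an antichain
this is the ascending order of the first coordinates, see `enumByX_strictMono`. -/
def enumByX (A : Finset (ℤ × ℤ)) (n : ℕ) (h : A.card = n) (i : Fin n) : ℤ × ℤ :=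
  ofLex ((A.map toLex.toEmbedding).orderEmbOfFin ((Finset.card_map _).trans h) i)

theorem enumByX_mem (A : Finset (ℤ × ℤ)) (n : ℕ) (h : A.card = n) (i : Fin n) :
    enumByX A n h i ∈ A := by
  have := (A.map toLex.toEmbedding).orderEmbOfFin_mem ((Finset.card_map _).trans h) i
  simpa [enumByX] using this

theorem enumByX_surj (A : Finset (ℤ × ℤ)) (n : ℕ) (h : A.card = n) {a : ℤ × ℤ} (ha : a ∈ A) :
    ∃ i, enumByX A n h i = a := by
  have h1 := (A.map toLex.toEmbedding).range_orderEmbOfFin ((Finset.card_map _).trans h)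
  have h2 : toLex a ∈ ((A.map toLex.toEmbedding : Finset (Lex (ℤ × ℤ))) : Set (Lex (ℤ × ℤ))) := by
    simpa using ha
  rw [← h1] at h2
  obtain ⟨i, hi⟩ := h2
  exact ⟨i, by rw [enumByX, hi]; rfl⟩

theorem enumByX_strictMono (A : Finset (ℤ × ℤ)) (n : ℕ) (h : A.card = n)
    (hA : ∀ a ∈ A, ∀ b ∈ A, ¬ a < b) : StrictMono fun i => (enumByX A n h i).1 := by
  intro i j hij
  have h1 := ((A.map toLex.toEmbedding).orderEmbOfFin ((Finset.card_map _).trans h)).strictMono hij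
  have h2 := hA _ (enumByX_mem A n h i) _ (enumByX_mem A n h j)
  rw [Prod.Lex.lt_iff] at h1
  rcases h1 with h1 | ⟨h1, h3⟩
  · exact h1
  · exact absurd (Prod.lt_iff.2 (Or.inr ⟨h1.le, h3⟩)) h2

theorem exists_minElems_le {I : Finset (ℤ × ℤ)} {r : ℤ × ℤ} (hr : r ∈ I) :
    ∃ p ∈ minElems I, p ≤ r := by
  obtain ⟨p, hp, hm⟩ := I.exists_le_minimal hr
  exact ⟨p, mem_minElems.2 ⟨hm.1, fun q hq h => h.not_ge (hm.2 hq h.le)⟩, hp⟩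

theorem exists_le_maxElems {I : Finset (ℤ × ℤ)} {r : ℤ × ℤ} (hr : r ∈ I) :
    ∃ p ∈ maxElems I, r ≤ p := by
  obtain ⟨p, hp, hm⟩ := I.exists_le_maximal hr
  exact ⟨p, mem_maxElems.2 ⟨hm.1, fun q hq h => h.not_ge (hm.2 hq h.le)⟩, hp⟩

theorem minElems_antichain (I : Finset (ℤ × ℤ)) : ∀ a ∈ minElems I, ∀ b ∈ minElems I, ¬ a < b :=
  fun _ ha _ hb => (mem_minElems.1 hb).2 _ (mem_minElems.1 ha).1

theorem maxElems_antichain (I : Finset (ℤ × ℤ)) : ∀ a ∈ maxElems I, ∀ b ∈ maxElems I, ¬ a < b :=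
  fun _ ha _ hb => (mem_maxElems.1 ha).2 _ (mem_maxElems.1 hb).1

/-- The number `k` for which the interval has `k + 1` minimal points. -/
noncomputable def numMin (I : FinInterval (ℤ × ℤ)) : ℕ := (minElems I.carrier).card - 1

/-- The number `ℓ` for which the interval has `ℓ + 1` maximal points. -/
noncomputable def numMax (I : FinInterval (ℤ × ℤ)) : ℕ := (maxElems I.carrier).card - 1

theorem card_minElems (I : FinInterval (ℤ × ℤ)) : (minElems I.carrier).card = numMin I + 1 := by
  obtain ⟨r, hr⟩ := I.nonempty
  obtain ⟨p, hp, -⟩ := exists_minElems_le hr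
  have := Finset.card_pos.2 ⟨p, hp⟩
  unfold numMin
  omega

theorem card_maxElems (I : FinInterval (ℤ × ℤ)) : (maxElems I.carrier).card = numMax I + 1 := by
  obtain ⟨r, hr⟩ := I.nonempty
  obtain ⟨p, hp, -⟩ := exists_le_maxElems hr
  have := Finset.card_pos.2 ⟨p, hp⟩
  unfold numMax
  omega

/-- The minimal points `p 0, …, p k`, listed in ascending order of the first coordinate. -/
noncomputable def minPt (I : FinInterval (ℤ × ℤ)) : Fin (numMin I + 1) → ℤ × ℤ :=
  enumByX (minElems I.carrier) (numMin I + 1) (card_minElems I)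

/-- The maximal points `q 0, …, q ℓ`, listed in ascending order of the first coordinate. -/
noncomputable def maxPt (I : FinInterval (ℤ × ℤ)) : Fin (numMax I + 1) → ℤ × ℤ :=
  enumByX (maxElems I.carrier) (numMax I + 1) (card_maxElems I)

theorem minPt_strictMono (I : FinInterval (ℤ × ℤ)) : StrictMono fun i => (minPt I i).1 :=
  enumByX_strictMono _ _ _ (minElems_antichain _)

theorem maxPt_strictMono (I : FinInterval (ℤ × ℤ)) : StrictMono fun i => (maxPt I i).1 :=
  enumByX_strictMono _ _ _ (maxElems_antichain _)

theorem range_minPt (I : FinInterval (ℤ × ℤ)) :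
    Set.range (minPt I) = (minElems I.carrier : Set (ℤ × ℤ)) :=
  Set.Subset.antisymm (by rintro _ ⟨i, rfl⟩; exact enumByX_mem _ _ _ i)
    fun _ ha => enumByX_surj _ _ _ ha

theorem range_maxPt (I : FinInterval (ℤ × ℤ)) :
    Set.range (maxPt I) = (maxElems I.carrier : Set (ℤ × ℤ)) :=
  Set.Subset.antisymm (by rintro _ ⟨i, rfl⟩; exact enumByX_mem _ _ _ i)
    fun _ ha => enumByX_surj _ _ _ ha

/-- The join of two neighbouring minimal points lies in the interval. -/
theorem sup_mem_of_consecutive (I : FinInterval (ℤ × ℤ)) {p q : ℤ × ℤ}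
    (hp : p ∈ minElems I.carrier) (hq : q ∈ minElems I.carrier) (hpq : p.1 < q.1)
    (hbetween : ∀ m ∈ minElems I.carrier, m.1 ≤ p.1 ∨ q.1 ≤ m.1) : p ⊔ q ∈ I.carrier := by
  by_contra hnot
  have hpI := (mem_minElems.1 hp).1
  have hqI := (mem_minElems.1 hq).1
  have key : ∀ r, Relation.ReflTransGen
      (fun a b => a ∈ I.carrier ∧ b ∈ I.carrier ∧ (a ≤ b ∨ b ≤ a)) p r →
      ∃ m ∈ minElems I.carrier, m ≤ r ∧ m.1 ≤ p.1 := by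
    intro r hr
    induction hr with
    | refl => exact ⟨p, hp, le_rfl, le_rfl⟩
    | @tail a b _ hab ih =>
      obtain ⟨m, hm, hma, hm1⟩ := ih
      obtain ⟨haI, hbI, hab | hba⟩ := hab
      · exact ⟨m, hm, hma.trans hab, hm1⟩
      · obtain ⟨n, hn, hnb⟩ := exists_minElems_le hbI
        rcases hbetween n hn with h | h
        · exact ⟨n, hn, hnb, h⟩
        · exfalso
          apply hnot
          have hna := hnb.trans hba
          have h2 : p.2 ≤ m.2 := by
            by_contra hlt
            exact minElems_antichain _ m hm p hp (Prod.lt_iff.2 (Or.inr ⟨hm1, by omega⟩))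
          have h3 : q.2 ≤ p.2 := by
            by_contra hlt
            exact minElems_antichain _ p hp q hq (Prod.lt_iff.2 (Or.inl ⟨hpq, by omega⟩))
          have hle : p ⊔ q ≤ a := by
            have e1 : p.1 ≤ a.1 := by have := hna.1; omega
            have e2 : p.2 ≤ a.2 := h2.trans hma.2
            exact sup_le ⟨e1, e2⟩ ⟨h.trans hna.1, h3.trans e2⟩
          exact I.convex hpI haI le_sup_left hle
  obtain ⟨m, hm, hmq, hm1⟩ := key q (I.connected hpI hqI)
  exact minElems_antichain _ m hm q hq (Prod.lt_iff.2 (Or.inl ⟨by omega, hmq.2⟩))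

/-- The meet of two neighbouring maximal points lies in the interval. -/
theorem inf_mem_of_consecutive (I : FinInterval (ℤ × ℤ)) {p q : ℤ × ℤ}
    (hp : p ∈ maxElems I.carrier) (hq : q ∈ maxElems I.carrier) (hpq : p.1 < q.1)
    (hbetween : ∀ m ∈ maxElems I.carrier, m.1 ≤ p.1 ∨ q.1 ≤ m.1) : p ⊓ q ∈ I.carrier := by
  by_contra hnot
  have hpI := (mem_maxElems.1 hp).1
  have hqI := (mem_maxElems.1 hq).1
  have key : ∀ r, Relation.ReflTransGen
      (fun a b => a ∈ I.carrier ∧ b ∈ I.carrier ∧ (a ≤ b ∨ b ≤ a)) q r →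
      ∃ m ∈ maxElems I.carrier, r ≤ m ∧ q.1 ≤ m.1 := by
    intro r hr
    induction hr with
    | refl => exact ⟨q, hq, le_rfl, le_rfl⟩
    | @tail a b _ hab ih =>
      obtain ⟨m, hm, hma, hm1⟩ := ih
      obtain ⟨haI, hbI, hab | hba⟩ := hab
      · obtain ⟨n, hn, hnb⟩ := exists_le_maxElems hbI
        rcases hbetween n hn with h | h
        · exfalso
          apply hnot
          have hna := hab.trans hnb
          have h2 : m.2 ≤ q.2 := by
            by_contra hlt
            exact maxElems_antichain _ q hq m hm (Prod.lt_iff.2 (Or.inr ⟨hm1, by omega⟩))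
          have h3 : q.2 ≤ p.2 := by
            by_contra hlt
            exact maxElems_antichain _ p hp q hq (Prod.lt_iff.2 (Or.inl ⟨hpq, by omega⟩))
          have hle : a ≤ p ⊓ q := by
            have e1 : a.1 ≤ p.1 := hna.1.trans h
            have e2 : a.2 ≤ q.2 := hma.2.trans h2
            exact le_inf ⟨e1, e2.trans h3⟩ ⟨e1.trans hpq.le, e2⟩
          exact I.convex haI hqI hle inf_le_right
        · exact ⟨n, hn, hnb, h⟩
      · exact ⟨m, hm, hba.trans hma, hm1⟩
  obtain ⟨m, hm, hpm, hm1⟩ := key p (I.connected hqI hpI)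
  exact maxElems_antichain _ p hp m hm (Prod.lt_iff.2 (Or.inl ⟨by omega, hpm.2⟩))

theorem minPt_sup_mem (I : FinInterval (ℤ × ℤ)) {i j : Fin (numMin I + 1)}
    (h : j.val = i.val ∨ j.val = i.val + 1) : minPt I i ⊔ minPt I j ∈ I.carrier := by
  rcases h with h | h
  · obtain rfl : j = i := Fin.ext h
    rw [sup_idem]
    exact (mem_minElems.1 (enumByX_mem _ _ _ j)).1
  · refine sup_mem_of_consecutive I (enumByX_mem _ _ _ i) (enumByX_mem _ _ _ j)
      (minPt_strictMono I (Fin.lt_def.2 (by omega))) ?_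
    intro m hm
    obtain ⟨s, rfl⟩ := enumByX_surj _ _ (card_minElems I) hm
    rcases Nat.lt_or_ge i.val s.val with hs | hs
    · exact Or.inr ((minPt_strictMono I).monotone (Fin.le_def.2 (by omega)))
    · exact Or.inl ((minPt_strictMono I).monotone (Fin.le_def.2 hs))

theorem maxPt_inf_mem (I : FinInterval (ℤ × ℤ)) {i j : Fin (numMax I + 1)}
    (h : j.val = i.val ∨ j.val = i.val + 1) : maxPt I i ⊓ maxPt I j ∈ I.carrier := by
  rcases h with h | h
  · obtain rfl : j = i := Fin.ext h
    rw [inf_idem]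
    exact (mem_maxElems.1 (enumByX_mem _ _ _ j)).1
  · refine inf_mem_of_consecutive I (enumByX_mem _ _ _ i) (enumByX_mem _ _ _ j)
      (maxPt_strictMono I (Fin.lt_def.2 (by omega))) ?_
    intro m hm
    obtain ⟨s, rfl⟩ := enumByX_surj _ _ (card_maxElems I) hm
    rcases Nat.lt_or_ge i.val s.val with hs | hs
    · exact Or.inr ((maxPt_strictMono I).monotone (Fin.le_def.2 (by omega)))
    · exact Or.inl ((maxPt_strictMono I).monotone (Fin.le_def.2 hs))

/-- The leftmost minimal point lies below the leftmost maximal point. -/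
theorem minPt_zero_le_maxPt_zero (I : FinInterval (ℤ × ℤ)) : minPt I 0 ≤ maxPt I 0 := by
  constructor
  · obtain ⟨m, hm, hle⟩ :=
      exists_minElems_le (mem_maxElems.1 (enumByX_mem _ _ (card_maxElems I) 0)).1
    obtain ⟨s, rfl⟩ := enumByX_surj _ _ (card_minElems I) hm
    exact ((minPt_strictMono I).monotone (Fin.zero_le s)).trans hle.1
  · obtain ⟨m, hm, hle⟩ :=
      exists_le_maxElems (mem_minElems.1 (enumByX_mem _ _ (card_minElems I) 0)).1
    obtain ⟨s, rfl⟩ := enumByX_surj _ _ (card_maxElems I) hm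
    refine hle.2.trans ?_
    by_contra hlt
    exact maxElems_antichain _ _ (enumByX_mem _ _ (card_maxElems I) 0) _
      (enumByX_mem _ _ (card_maxElems I) s)
      (Prod.lt_iff.2 (Or.inr ⟨(maxPt_strictMono I).monotone (Fin.zero_le s), not_le.1 hlt⟩))

/-! ### The boundary cap -/

/-- The `2 k + 1` terms `p 0 < p 0 ⊔ p 1 > p 1 < ⋯ > p k` of the lower zigzag: the term number `t`
(from `0`) is `p i` if `t = 2 i`, and `p i ⊔ p (i + 1)` if `t = 2 i + 1`. -/
noncomputable def minZZ (I : FinInterval (ℤ × ℤ)) (t : Fin (2 * numMin I + 1)) : ℤ × ℤ :=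
  minPt I ⟨t / 2, by omega⟩ ⊔ minPt I ⟨(t + 1) / 2, by omega⟩

/-- The `2 ℓ + 1` terms `q 0 > q 0 ⊓ q 1 < q 1 > ⋯ < q ℓ` of the upper zigzag: the term number `t`
(from `0`) is `q i` if `t = 2 i`, and `q i ⊓ q (i + 1)` if `t = 2 i + 1`. -/
noncomputable def maxZZ (I : FinInterval (ℤ × ℤ)) (t : Fin (2 * numMax I + 1)) : ℤ × ℤ :=
  maxPt I ⟨t / 2, by omega⟩ ⊓ maxPt I ⟨(t + 1) / 2, by omega⟩

/-- The zigzag poset `0 < 1 > 2 < 3 > ⋯` on `n` points; it has no relations besides these (and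
reflexivity). In particular `Fin n` is used only as the underlying set. -/
def Zigzag (n : ℕ) : Type := Fin n

instance (n : ℕ) : Fintype (Zigzag n) := inferInstanceAs (Fintype (Fin n))

instance (n : ℕ) : DecidableEq (Zigzag n) := inferInstanceAs (DecidableEq (Fin n))

/-- The position of a point of the zigzag poset, counted from `0`. -/
def Zigzag.pos {n : ℕ} (x : Zigzag n) : ℕ := Fin.val x

theorem Zigzag.pos_lt {n : ℕ} (x : Zigzag n) : x.pos < n := Fin.isLt x

instance (n : ℕ) : PartialOrder (Zigzag n) where
  le x y := x = y ∨ (Even x.pos ∧ (y.pos = x.pos + 1 ∨ x.pos = y.pos + 1))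
  le_refl x := Or.inl rfl
  le_trans x y z hxy hyz := by
    rcases hxy with rfl | ⟨hx, h⟩
    · exact hyz
    · rcases hyz with rfl | ⟨hy, -⟩
      · exact Or.inr ⟨hx, h⟩
      · rw [Nat.even_iff] at hx hy
        omega
  le_antisymm x y hxy hyx := by
    rcases hxy with rfl | ⟨hx, h⟩
    · rfl
    · rcases hyx with rfl | ⟨hy, -⟩
      · rfl
      · rw [Nat.even_iff] at hx hy
        omega

theorem Zigzag.le_def {n : ℕ} {x y : Zigzag n} :
    x ≤ y ↔ x = y ∨ (Even x.pos ∧ (y.pos = x.pos + 1 ∨ x.pos = y.pos + 1)) := Iff.rfl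

/-- The zigzag poset underlying the boundary cap. It has `(2 k + 1) + (2 ℓ + 1)` points: the first
`2 k + 1` are `• < • > • < ⋯ > •`, the last `2 ℓ + 1` are `∘ > ∘ < ∘ > ⋯ < ∘`, and the last `•` is
below the first `∘`. With positions counted from `0`, the even points are thus the minimal ones. -/
abbrev CapPoset (I : FinInterval (ℤ × ℤ)) : Type := Zigzag ((2 * numMin I + 1) + (2 * numMax I + 1))

/-- The boundary cap
`p k < p k ⊔ p (k - 1) > p (k - 1) < ⋯ > p 0 ≤ q 0 > q 0 ⊓ q 1 < q 1 > ⋯ < q ℓ`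
of an interval: the lower zigzag read backwards, followed by the upper zigzag. -/
noncomputable def boundaryCap (I : FinInterval (ℤ × ℤ)) (x : CapPoset I) : ℤ × ℤ :=
  if h : x.pos < 2 * numMin I + 1 then minZZ I ⟨2 * numMin I - x.pos, by omega⟩
  else maxZZ I ⟨x.pos - (2 * numMin I + 1), by have := x.pos_lt; omega⟩

theorem boundaryCap_mem (I : FinInterval (ℤ × ℤ)) (x : CapPoset I) :
    boundaryCap I x ∈ I.carrier := by
  unfold boundaryCap
  split_ifs with h
  · exact minPt_sup_mem I (by dsimp only; omega)
  · exact maxPt_inf_mem I (by dsimp only; omega)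

theorem minZZ_le (I : FinInterval (ℤ × ℤ)) {s t : Fin (2 * numMin I + 1)} (hs : Even s.val)
    (h : t.val = s.val + 1 ∨ s.val = t.val + 1) : minZZ I s ≤ minZZ I t := by
  rw [Nat.even_iff] at hs
  unfold minZZ
  rcases h with h | h
  · refine le_trans (le_of_eq ?_) le_sup_left
    rw [show (⟨((s : ℕ) + 1) / 2, by omega⟩ : Fin (numMin I + 1)) = ⟨s / 2, by omega⟩ from
      Fin.ext (by dsimp only; omega), sup_idem]
    exact congrArg _ (Fin.ext (by dsimp only; omega))
  · refine le_trans (le_of_eq ?_) le_sup_right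
    rw [show (⟨((s : ℕ) + 1) / 2, by omega⟩ : Fin (numMin I + 1)) = ⟨s / 2, by omega⟩ from
      Fin.ext (by dsimp only; omega), sup_idem]
    exact congrArg _ (Fin.ext (by dsimp only; omega))

theorem le_maxZZ (I : FinInterval (ℤ × ℤ)) {s t : Fin (2 * numMax I + 1)} (ht : Even t.val)
    (h : t.val = s.val + 1 ∨ s.val = t.val + 1) : maxZZ I s ≤ maxZZ I t := by
  rw [Nat.even_iff] at ht
  unfold maxZZ
  rcases h with h | h
  · refine le_trans inf_le_right (le_of_eq ?_)
    rw [show (⟨((t : ℕ) + 1) / 2, by omega⟩ : Fin (numMax I + 1)) = ⟨t / 2, by omega⟩ from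
      Fin.ext (by dsimp only; omega), inf_idem]
    exact congrArg _ (Fin.ext (by dsimp only; omega))
  · refine le_trans inf_le_left (le_of_eq ?_)
    rw [show (⟨((t : ℕ) + 1) / 2, by omega⟩ : Fin (numMax I + 1)) = ⟨t / 2, by omega⟩ from
      Fin.ext (by dsimp only; omega), inf_idem]
    exact congrArg _ (Fin.ext (by dsimp only; omega))

theorem boundaryCap_monotone (I : FinInterval (ℤ × ℤ)) : Monotone (boundaryCap I) := by
  intro x y hxy
  rcases Zigzag.le_def.1 hxy with rfl | ⟨hx, h⟩
  · exact le_rfl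
  · have hx1 := x.pos_lt
    have hy1 := y.pos_lt
    have hx2 := Nat.even_iff.1 hx
    unfold boundaryCap
    split_ifs with h1 h2 h2
    · exact minZZ_le I (Nat.even_iff.2 (by dsimp only; omega)) (by dsimp only; omega)
    · have e1 : ∀ (i : Fin (numMin I + 1)), i.val = 0 → minPt I i = minPt I 0 :=
        fun i hi => congrArg _ (Fin.ext hi)
      have e2 : ∀ (i : Fin (numMax I + 1)), i.val = 0 → maxPt I i = maxPt I 0 :=
        fun i hi => congrArg _ (Fin.ext hi)
      unfold minZZ maxZZ
      refine (sup_le (e1 _ ?_).le (e1 _ ?_).le).trans ((minPt_zero_le_maxPt_zero I).trans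
        (le_inf (e2 _ ?_).ge (e2 _ ?_).ge)) <;> (dsimp only; omega)
    · exfalso
      omega
    · exact le_maxZZ I (Nat.even_iff.2 (by dsimp only; omega)) (by dsimp only; omega)

/-- The order-preserving map from the zigzag poset to the interval, whose image is the
boundary cap. -/
noncomputable def capMap (I : FinInterval (ℤ × ℤ)) : CapPoset I →o I.carrier where
  toFun x := ⟨boundaryCap I x, boundaryCap_mem I x⟩
  monotone' _ _ h := boundaryCap_monotone I h

/-- The zigzag module along the boundary cap: the module `M` precomposed with `capMap I`. -/
noncomputable def boundaryModule {𝔽 : Type u} [Field 𝔽] (I : FinInterval (ℤ × ℤ))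
    (M : I.carrier ⥤ FGModuleCat.{u} 𝔽) : CapPoset I ⥤ FGModuleCat.{u} 𝔽 :=
  (capMap I).monotone.functor ⋙ M

end ZigzagRank

/-! The equality and the existence of a barcode rest on one duality. An element of the limit is a
compatible family of vectors (a section), and a functional on the colimit is a compatible family of
functionals (a cosection). Functionals separate the points of the colimit, so a vector dies there
exactly if every cosection kills it. Hence the generalized rank is determined by two data: which
vectors at `p 0` are values of sections, and which of them are killed, after transport to `q 0`, by
all cosections.

Both data are the same for `M` and for its restriction to the boundary cap
(`generalizedRank_boundaryModule`). Given a section along the cap, a section on the interval is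
built by transporting to `r` its value at any minimal point below `r`. This is well defined: along
the minimal points `x` increases and `y` decreases, so those below `r` have consecutive indices, and
neighbours already agree at their join, which is a term of the cap and lies below `r`. The argument
for cosections is dual, with maximal points and meets. The extension need only agree with the
original at `p 0`, respectively `q 0`.

For a sum of interval modules over a connected poset, the pairing of a section with a cosection is
constant. The part of a section in a summand that misses some point pairs to zero there, hence
everywhere; only the full intervals contribute, each one dimension (`generalizedRank_directSum`).

A barcode exists by induction on the total dimension (`hasIntervalBasis_zigzag`). Starting from a
nonzero vector at the leftmost nonzero space, `exists_section_cosection_segment` finds a segment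
with a section on it and a cosection pairing to `1` with it. Extended by zero, the section spans an
interval module, and the kernels of the cosection form a complement of smaller dimension. -/

namespace ZigzagRank

/-! ### Limits and colimits through sections and cosections. -/

variable {𝔽 : Type u} [Field 𝔽] {P : Type} [PartialOrder P]

/-- The linear map of a persistence module belonging to a relation `p ≤ q`. -/
abbrev transition (M : P ⥤ FGModuleCat.{u} 𝔽) {p q : P} (h : p ≤ q) :
    M.obj p →ₗ[𝔽] M.obj q := (M.map (homOfLE h)).hom.hom

theorem transition_refl (M : P ⥤ FGModuleCat.{u} 𝔽) (p : P) (v : M.obj p) :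
    transition M (le_refl p) v = v := by
  change (M.map (𝟙 p)).hom.hom v = v
  rw [M.map_id]
  rfl

theorem transition_trans (M : P ⥤ FGModuleCat.{u} 𝔽) {p q r : P} (h : p ≤ q) (h' : q ≤ r)
    (v : M.obj p) : transition M h' (transition M h v) = transition M (h.trans h') v := by
  change _ = (M.map (homOfLE h ≫ homOfLE h')).hom.hom v
  rw [M.map_comp]
  rfl

/-- A family of vectors that is compatible with the relations between points of `S`. -/
def IsSection (M : P ⥤ FGModuleCat.{u} 𝔽) (S : Set P) (s : ∀ p, M.obj p) : Prop :=
  ∀ ⦃p q : P⦄ (h : p ≤ q), p ∈ S → q ∈ S → transition M h (s p) = s q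

/-- A family of functionals that is compatible with the relations between points of `S`. -/
def IsCosection (M : P ⥤ FGModuleCat.{u} 𝔽) (S : Set P) (φ : ∀ p, M.obj p →ₗ[𝔽] 𝔽) : Prop :=
  ∀ ⦃p q : P⦄ (h : p ≤ q), p ∈ S → q ∈ S → φ q ∘ₗ transition M h = φ p

section Limits

variable [Fintype P] (M : P ⥤ FGModuleCat.{u} 𝔽)

theorem isSection_limit (x : ↑(limit M)) :
    IsSection M Set.univ fun p => (limit.π M p).hom.hom x := by
  intro p q h _ _
  conv_rhs => beta_reduce; rw [← limit.w M (homOfLE h)]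
  rfl

theorem exists_limit_element {s : ∀ p, M.obj p} (hs : IsSection M Set.univ s) :
    ∃ x : ↑(limit M), ∀ p, (limit.π M p).hom.hom x = s p := by
  let c : Cone M :=
    { pt := FGModuleCat.of 𝔽 𝔽
      π :=
        { app := fun p => FGModuleCat.ofHom (LinearMap.toSpanSingleton 𝔽 _ (s p))
          naturality := by
            intro p q f
            apply FGModuleCat.hom_ext
            apply LinearMap.ext
            intro a
            change a • s q = (M.map f).hom.hom (a • s p)
            rw [map_smul]
            exact congrArg _ (hs (leOfHom f) trivial trivial).symm } }
  refine ⟨(limit.lift M c).hom.hom (1 : 𝔽), fun p => ?_⟩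
  change (limit.lift M c ≫ limit.π M p).hom.hom (1 : 𝔽) = s p
  rw [limit.lift_π]
  exact one_smul 𝔽 (s p)

theorem exists_colimit_functional {φ : ∀ p, M.obj p →ₗ[𝔽] 𝔽} (hφ : IsCosection M Set.univ φ) :
    ∃ f : ↑(colimit M) →ₗ[𝔽] 𝔽, ∀ p v, f ((colimit.ι M p).hom.hom v) = φ p v := by
  let c : Cocone M :=
    { pt := FGModuleCat.of 𝔽 𝔽
      ι :=
        { app := fun p => FGModuleCat.ofHom (φ p)
          naturality := by
            intro p q f
            apply FGModuleCat.hom_ext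
            exact hφ (leOfHom f) trivial trivial } }
  refine ⟨(colimit.desc M c).hom.hom, fun p v => ?_⟩
  change (colimit.ι M p ≫ colimit.desc M c).hom.hom v = φ p v
  rw [colimit.ι_desc]
  rfl

theorem isCosection_colimit (f : ↑(colimit M) →ₗ[𝔽] 𝔽) :
    IsCosection M Set.univ fun p => f ∘ₗ (colimit.ι M p).hom.hom := by
  intro p q h _ _
  conv_rhs => beta_reduce; rw [← colimit.w M (homOfLE h)]
  rfl

/-- Functionals on a vector space separate its points, and those on the colimit are the cosections.
This replaces any explicit description of the colimit. -/
theorem colimit_ι_eq_zero_iff {p : P} (v : M.obj p) :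
    (colimit.ι M p).hom.hom v = 0 ↔ ∀ φ, IsCosection M Set.univ φ → φ p v = 0 := by
  constructor
  · intro h φ hφ
    obtain ⟨f, hf⟩ := exists_colimit_functional M hφ
    rw [← hf, h, map_zero]
  · intro h
    exact (Module.forall_dual_apply_eq_zero_iff 𝔽 _).1 fun f => h _ (isCosection_colimit M f)

theorem mem_range_limit_π_iff {p : P} (v : M.obj p) :
    v ∈ LinearMap.range (limit.π M p).hom.hom ↔ ∃ s, IsSection M Set.univ s ∧ s p = v := by
  constructor
  · rintro ⟨x, rfl⟩
    exact ⟨_, isSection_limit M x, rfl⟩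
  · rintro ⟨s, hs, rfl⟩
    obtain ⟨x, hx⟩ := exists_limit_element M hs
    exact ⟨x, hx p⟩

/-- Two points are used because the limit will be controlled at the leftmost minimal point and the
colimit at the leftmost maximal point. -/
theorem generalizedRank_eq_finrank_map {p q : P} (h : p ≤ q) :
    generalizedRank M p = Module.finrank 𝔽 ((LinearMap.range (limit.π M p).hom.hom).map
      ((colimit.ι M q).hom.hom ∘ₗ transition M h)) := by
  rw [generalizedRank, ← LinearMap.range_comp]
  have : limToColim M p = limit.π M p ≫ M.map (homOfLE h) ≫ colimit.ι M q := by
    rw [colimit.w]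
    rfl
  rw [this]
  rfl

theorem generalizedRank_eq_of_chain {p q : P}
    (h : Relation.ReflTransGen (fun a b : P => a ≤ b ∨ b ≤ a) p q) :
    generalizedRank M p = generalizedRank M q := by
  rw [generalizedRank, generalizedRank, limToColim_eq M h]

theorem generalizedRank_congr {N : P ⥤ FGModuleCat.{u} 𝔽} (e : M ≅ N) (p : P) :
    generalizedRank M p = generalizedRank N p := by
  have h : limToColim N p = (HasLimit.isoOfNatIso e.symm).hom ≫ limToColim M p ≫
      (HasColimit.isoOfNatIso e).hom := by
    simp [limToColim]
  let α := FGModuleCat.isoToLinearEquiv (HasLimit.isoOfNatIso e.symm)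
  let β := FGModuleCat.isoToLinearEquiv (HasColimit.isoOfNatIso e)
  have h' : (limToColim N p).hom.hom = β.toLinearMap ∘ₗ (limToColim M p).hom.hom ∘ₗ
      α.toLinearMap := by
    rw [h]; rfl
  rw [generalizedRank, generalizedRank, h', LinearMap.range_comp, LinearEquiv.finrank_map_eq,
    LinearMap.range_comp_of_range_eq_top _ α.range]

end Limits

/-- Rank-nullity on `E`. The targets will be two different colimits, of which only the kernels can
be compared. -/
theorem finrank_map_eq_of_ker_eq {V W W' : Type*} [AddCommGroup V] [Module 𝔽 V]
    [AddCommGroup W] [Module 𝔽 W] [AddCommGroup W'] [Module 𝔽 W'] [FiniteDimensional 𝔽 V]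
    (E : Submodule 𝔽 V) (f : V →ₗ[𝔽] W) (g : V →ₗ[𝔽] W') (h : ∀ v, f v = 0 ↔ g v = 0) :
    Module.finrank 𝔽 (E.map f) = Module.finrank 𝔽 (E.map g) := by
  have hf := LinearMap.finrank_range_add_finrank_ker (f.domRestrict E)
  have hg := LinearMap.finrank_range_add_finrank_ker (g.domRestrict E)
  have hk : LinearMap.ker (f.domRestrict E) = LinearMap.ker (g.domRestrict E) := by
    ext v
    simp [h]
  rw [LinearMap.range_domRestrict] at hf hg
  rw [hk] at hf
  omega

end ZigzagRank

namespace ZigzagRank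

variable {𝔽 : Type u} [Field 𝔽] {P : Type} [PartialOrder P]

/-! ### The generalized rank of a direct sum of interval modules -/

/-- The space of an interval module at a point, as a space of functions. -/
noncomputable def intervalEquiv (𝔽 : Type u) [Field 𝔽] (J : FinInterval P) (p : P) :
    (intervalModule 𝔽 J).obj p ≃ₗ[𝔽] (PLift (p ∈ J.carrier) → 𝔽) :=
  LinearEquiv.refl 𝔽 (PLift (p ∈ J.carrier) → 𝔽)

/-- The space of a direct sum at a point, as a product. -/
noncomputable def directSumEquiv {n : ℕ} (N : Fin n → (P ⥤ FGModuleCat.{u} 𝔽)) (p : P) :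
    (directSum N).obj p ≃ₗ[𝔽] ∀ i, (N i).obj p :=
  LinearEquiv.refl 𝔽 (∀ i, (N i).obj p)

theorem intervalEquiv_transition_of_mem (J : FinInterval P) {p q : P} (h : p ≤ q)
    (v : (intervalModule 𝔽 J).obj p) (hp : p ∈ J.carrier) (hq : PLift (q ∈ J.carrier)) :
    intervalEquiv 𝔽 J q (transition _ h v) hq = intervalEquiv 𝔽 J p v ⟨hp⟩ :=
  dif_pos hp

theorem intervalEquiv_transition_of_notMem (J : FinInterval P) {p q : P} (h : p ≤ q)
    (v : (intervalModule 𝔽 J).obj p) (hp : p ∉ J.carrier) (hq : PLift (q ∈ J.carrier)) :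
    intervalEquiv 𝔽 J q (transition _ h v) hq = 0 :=
  dif_neg hp

/-- The coordinates of a vector in a direct sum of interval modules. -/
noncomputable def intervalCoord {n : ℕ} (J : Fin n → FinInterval P) (p : P) :
    (directSum fun i => intervalModule 𝔽 (J i)).obj p ≃ₗ[𝔽]
      ∀ i, PLift (p ∈ (J i).carrier) → 𝔽 :=
  (directSumEquiv _ p).trans (LinearEquiv.piCongrRight fun i => intervalEquiv 𝔽 (J i) p)

theorem intervalCoord_transition_of_mem {n : ℕ} (J : Fin n → FinInterval P) {p q : P} (h : p ≤ q)
    (v : (directSum fun i => intervalModule 𝔽 (J i)).obj p) {i : Fin n} (hp : p ∈ (J i).carrier)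
    (hq : PLift (q ∈ (J i).carrier)) :
    intervalCoord J q (transition _ h v) i hq = intervalCoord J p v i ⟨hp⟩ :=
  intervalEquiv_transition_of_mem (J i) h _ hp hq

theorem intervalCoord_transition_of_notMem {n : ℕ} (J : Fin n → FinInterval P) {p q : P}
    (h : p ≤ q) (v : (directSum fun i => intervalModule 𝔽 (J i)).obj p) {i : Fin n}
    (hp : p ∉ (J i).carrier) (hq : PLift (q ∈ (J i).carrier)) :
    intervalCoord J q (transition _ h v) i hq = 0 :=
  intervalEquiv_transition_of_notMem (J i) h _ hp hq

theorem pairing_eq_of_chain {M : P ⥤ FGModuleCat.{u} 𝔽} {s : ∀ p, M.obj p}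
    {φ : ∀ p, M.obj p →ₗ[𝔽] 𝔽} (hs : IsSection M Set.univ s) (hφ : IsCosection M Set.univ φ)
    {p q : P} (h : Relation.ReflTransGen (fun a b : P => a ≤ b ∨ b ≤ a) p q) :
    φ p (s p) = φ q (s q) := by
  have key : ∀ {a b : P}, a ≤ b → φ a (s a) = φ b (s b) := by
    intro a b hab
    rw [← hφ hab trivial trivial, LinearMap.comp_apply, hs hab trivial trivial]
  induction h with
  | refl => rfl
  | tail _ hbc ih => exact ih.trans (hbc.elim key fun h => (key h).symm)

section

variable {n : ℕ} (J : Fin n → FinInterval P)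

/-- The part of a section of a direct sum of interval modules that lies in one summand. -/
theorem isSection_single {s : ∀ p, (directSum fun i => intervalModule 𝔽 (J i)).obj p}
    (hs : IsSection _ Set.univ s) (i : Fin n) :
    IsSection (directSum fun i => intervalModule 𝔽 (J i)) Set.univ
      fun p => (intervalCoord J p).symm (Pi.single i (intervalCoord J p (s p) i)) := by
  intro p q h _ _
  apply (intervalCoord J q).injective
  funext j hq
  rw [LinearEquiv.apply_symm_apply]
  have h2 := congrArg (fun w => intervalCoord J q w j hq) (hs h trivial trivial)
  by_cases hp : p ∈ (J j).carrier
  · rw [intervalCoord_transition_of_mem J h _ hp] at h2 ⊢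
    rw [LinearEquiv.apply_symm_apply]
    obtain rfl | hij := eq_or_ne j i
    · rw [Pi.single_eq_same, Pi.single_eq_same, h2]
    · rw [Pi.single_eq_of_ne hij, Pi.single_eq_of_ne hij]
      rfl
  · rw [intervalCoord_transition_of_notMem J h _ hp] at h2 ⊢
    obtain rfl | hij := eq_or_ne j i
    · rw [Pi.single_eq_same, h2]
    · rw [Pi.single_eq_of_ne hij]
      rfl

theorem isCosection_coord {i : Fin n} (hi : ∀ p, p ∈ (J i).carrier) :
    IsCosection (directSum fun i => intervalModule 𝔽 (J i)) Set.univ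
      fun p => LinearMap.proj ⟨hi p⟩ ∘ₗ LinearMap.proj i ∘ₗ (intervalCoord J p).toLinearMap := by
  intro p q h _ _
  ext v
  exact intervalCoord_transition_of_mem J h v (hi p) ⟨hi q⟩

variable [Fintype P]

/-- The section with constant coordinates at the full intervals and zero coordinates elsewhere. -/
noncomputable def fullSection (p : P) : ({i // (J i).carrier = Finset.univ} → 𝔽) →ₗ[𝔽]
    (directSum fun i => intervalModule 𝔽 (J i)).obj p := by
  classical exact (intervalCoord J p).symm.toLinearMap ∘ₗ LinearMap.pi fun i =>
    LinearMap.pi fun _ => if h : (J i).carrier = Finset.univ then LinearMap.proj ⟨i, h⟩ else 0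

theorem intervalCoord_fullSection_of_full (p : P) (c : {i // (J i).carrier = Finset.univ} → 𝔽)
    {i : Fin n} (h : (J i).carrier = Finset.univ) (hp : PLift (p ∈ (J i).carrier)) :
    intervalCoord J p (fullSection J p c) i hp = c ⟨i, h⟩ := by
  simp [fullSection, h]

theorem intervalCoord_fullSection_of_not_full (p : P)
    (c : {i // (J i).carrier = Finset.univ} → 𝔽) {i : Fin n} (h : (J i).carrier ≠ Finset.univ)
    (hp : PLift (p ∈ (J i).carrier)) : intervalCoord J p (fullSection J p c) i hp = 0 := by
  simp [fullSection, h]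

theorem isSection_fullSection (c : {i // (J i).carrier = Finset.univ} → 𝔽) :
    IsSection (directSum fun i => intervalModule 𝔽 (J i)) Set.univ
      fun p => fullSection J p c := by
  intro p q h _ _
  apply (intervalCoord J q).injective
  funext i hq
  by_cases hi : (J i).carrier = Finset.univ
  · have hp : p ∈ (J i).carrier := by rw [hi]; exact Finset.mem_univ p
    rw [intervalCoord_transition_of_mem J h _ hp, intervalCoord_fullSection_of_full J p c hi,
      intervalCoord_fullSection_of_full J q c hi]
  · rw [intervalCoord_fullSection_of_not_full J q c hi]
    by_cases hp : p ∈ (J i).carrier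
    · rw [intervalCoord_transition_of_mem J h _ hp, intervalCoord_fullSection_of_not_full J p c hi]
    · rw [intervalCoord_transition_of_notMem J h _ hp]

/-- The component of `s` in a summand that is not full is itself a section. Its pairing with `φ`
does not depend on the point, and it is zero at a point `r` outside the interval. So, as far as
cosections can see, only the coordinates at full intervals matter. -/
theorem cosection_eq_on_fullSection
    (hconn : ∀ p q : P, Relation.ReflTransGen (fun a b : P => a ≤ b ∨ b ≤ a) p q)
    {s : ∀ p, (directSum fun i => intervalModule 𝔽 (J i)).obj p} (hs : IsSection _ Set.univ s)
    {φ : ∀ p, (directSum fun i => intervalModule 𝔽 (J i)).obj p →ₗ[𝔽] 𝔽}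
    (hφ : IsCosection _ Set.univ φ) (p : P) :
    φ p (s p) = φ p (fullSection J p fun i =>
      intervalCoord J p (s p) i.1 ⟨by rw [i.2]; exact Finset.mem_univ p⟩) := by
  have hdecomp : ∀ v, φ p v =
      ∑ i, φ p ((intervalCoord J p).symm (Pi.single i (intervalCoord J p v i))) := by
    intro v
    rw [← map_sum, ← map_sum, Finset.univ_sum_single, LinearEquiv.symm_apply_apply]
  rw [hdecomp, hdecomp (fullSection _ _ _)]
  refine Finset.sum_congr rfl fun i _ => ?_
  by_cases hi : (J i).carrier = Finset.univ
  · congr 3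
    funext hp
    rw [intervalCoord_fullSection_of_full J p _ hi]
  · have h0 : intervalCoord J p (fullSection J p fun i =>
        intervalCoord J p (s p) i.1 ⟨by rw [i.2]; exact Finset.mem_univ p⟩) i = 0 :=
      funext fun hp => intervalCoord_fullSection_of_not_full J p _ hi hp
    rw [h0, Pi.single_zero, map_zero, map_zero]
    obtain ⟨r, hr⟩ : ∃ r, r ∉ (J i).carrier := by
      simpa [Finset.eq_univ_iff_forall] using hi
    refine (pairing_eq_of_chain (isSection_single J hs i) hφ (hconn p r)).trans ?_
    have h1 : intervalCoord J r (s r) i = 0 := funext fun h => absurd h.down hr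
    rw [h1, Pi.single_zero, map_zero, map_zero]

/-- In the colimit every section becomes equal to a full section, and the coordinate functionals of
the full intervals, being cosections, keep the full sections independent there. -/
theorem generalizedRank_directSum
    (hconn : ∀ p q : P, Relation.ReflTransGen (fun a b : P => a ≤ b ∨ b ≤ a) p q) (p : P) :
    generalizedRank (directSum fun i => intervalModule 𝔽 (J i)) p =
      Nat.card {i // (J i).carrier = Finset.univ} := by
  classical
  rw [generalizedRank_eq_finrank_map _ (le_refl p)]
  have htr : transition (directSum fun i => intervalModule 𝔽 (J i)) (le_refl p) =
      LinearMap.id := LinearMap.ext (transition_refl _ p)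
  rw [htr, LinearMap.comp_id]
  have hmap : (LinearMap.range (limit.π (directSum fun i => intervalModule 𝔽 (J i)) p).hom.hom).map
      (colimit.ι (directSum fun i => intervalModule 𝔽 (J i)) p).hom.hom =
      LinearMap.range ((colimit.ι (directSum fun i => intervalModule 𝔽 (J i)) p).hom.hom ∘ₗ
        fullSection J p) := by
    apply le_antisymm
    · rintro _ ⟨v, hv, rfl⟩
      obtain ⟨s, hs, rfl⟩ := (mem_range_limit_π_iff _ v).1 hv
      refine ⟨fun i => intervalCoord J p (s p) i.1 ⟨by rw [i.2]; exact Finset.mem_univ p⟩,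
        (sub_eq_zero.1 ?_).symm⟩
      rw [LinearMap.comp_apply, ← map_sub, colimit_ι_eq_zero_iff]
      intro φ hφ
      rw [map_sub, sub_eq_zero]
      exact cosection_eq_on_fullSection J hconn hs hφ p
    · rintro _ ⟨c, rfl⟩
      exact ⟨_, (mem_range_limit_π_iff _ _).2 ⟨_, isSection_fullSection J c, rfl⟩, rfl⟩
  rw [hmap, LinearMap.finrank_range_of_inj]
  · rw [Module.finrank_fintype_fun_eq_card, Nat.card_eq_fintype_card]
  · rw [injective_iff_map_eq_zero]
    intro c hc
    funext i
    have hi : ∀ p, p ∈ (J i.1).carrier := fun p => by rw [i.2]; exact Finset.mem_univ p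
    have := (colimit_ι_eq_zero_iff _ _).1 hc _ (isCosection_coord J hi)
    exact (intervalCoord_fullSection_of_full J p c i.2 ⟨hi p⟩).symm.trans this

variable [DecidableEq P]

theorem fullMultiplicity_map :
    fullMultiplicity (Finset.univ.val.map J) = Nat.card {i // (J i).carrier = Finset.univ} := by
  classical
  rw [fullMultiplicity, Multiset.countP_map, Nat.card_eq_fintype_card, Fintype.card_subtype]
  rfl

end

theorem generalizedRank_eq_fullMultiplicity [Fintype P] [DecidableEq P]
    {M : P ⥤ FGModuleCat.{u} 𝔽} {B : Multiset (FinInterval P)} (hB : IsBarcode M B)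
    (hconn : ∀ p q : P, Relation.ReflTransGen (fun a b : P => a ≤ b ∨ b ≤ a) p q) (p : P) :
    generalizedRank M p = fullMultiplicity B := by
  obtain ⟨n, J, rfl, ⟨e⟩⟩ := hB
  rw [generalizedRank_congr M e, generalizedRank_directSum J hconn, fullMultiplicity_map]

end ZigzagRank

namespace ZigzagRank

/-! ### The generalized rank along the boundary cap -/

/-- The points of a zigzag poset at the positions from `a` to `b`. -/
def Zigzag.segment (n a b : ℕ) : Set (Zigzag n) := {x | a ≤ x.pos ∧ x.pos ≤ b}

theorem Zigzag.segment_chain {n a b : ℕ} {x y : Zigzag n} (hx : x ∈ segment n a b)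
    (hy : y ∈ segment n a b) : Relation.ReflTransGen
      (fun u v => u ∈ segment n a b ∧ v ∈ segment n a b ∧ (u ≤ v ∨ v ≤ u)) x y := by
  have key : ∀ (d : ℕ) (x y : Zigzag n), x ∈ segment n a b → y ∈ segment n a b →
      y.pos = x.pos + d → Relation.ReflTransGen
        (fun u v => u ∈ segment n a b ∧ v ∈ segment n a b ∧ (u ≤ v ∨ v ≤ u)) x y := by
    intro d
    induction d with
    | zero =>
      intro x y _ _ h
      obtain rfl : y = x := Fin.ext h
      exact .refl
    | succ d ih =>
      intro x y hx hy h
      have hlt := y.pos_lt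
      let z : Zigzag n := (⟨x.pos + d, by omega⟩ : Fin n)
      have hzpos : z.pos = x.pos + d := rfl
      have hz : z ∈ segment n a b := ⟨by have := hx.1; omega, by have := hy.2; omega⟩
      refine (ih x z hx hz hzpos).tail ⟨hz, hy, ?_⟩
      rcases Nat.even_or_odd z.pos with ht | ht
      · exact Or.inl (Or.inr ⟨ht, Or.inl (by omega)⟩)
      · refine Or.inr (Or.inr ⟨?_, Or.inr (by omega)⟩)
        rw [h, ← add_assoc, ← hzpos]
        exact ht.add_one
  rcases Nat.le_total x.pos y.pos with h | h
  · obtain ⟨d, hd⟩ := Nat.exists_eq_add_of_le h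
    exact key d x y hx hy hd
  · obtain ⟨d, hd⟩ := Nat.exists_eq_add_of_le h
    have hsymm : Std.Symm
        (fun u v => u ∈ segment n a b ∧ v ∈ segment n a b ∧ (u ≤ v ∨ v ≤ u)) :=
      ⟨fun _ _ h => ⟨h.2.1, h.1, h.2.2.symm⟩⟩
    exact Relation.ReflTransGen.stdSymm.symm _ _ (key d y x hy hx hd)

theorem Zigzag.chain {n : ℕ} (x y : Zigzag n) :
    Relation.ReflTransGen (fun a b : Zigzag n => a ≤ b ∨ b ≤ a) x y :=
  Relation.ReflTransGen.mono (fun _ _ h => h.2.2) _ _ (segment_chain (a := 0) (b := n)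
    ⟨x.pos.zero_le, x.pos_lt.le⟩ ⟨y.pos.zero_le, y.pos_lt.le⟩)

theorem FinInterval.chain (I : FinInterval (ℤ × ℤ)) (p q : I.carrier) :
    Relation.ReflTransGen (fun a b : I.carrier => a ≤ b ∨ b ≤ a) p q := by
  have key : ∀ r, Relation.ReflTransGen
      (fun a b => a ∈ I.carrier ∧ b ∈ I.carrier ∧ (a ≤ b ∨ b ≤ a)) p.1 r → ∀ hr : r ∈ I.carrier,
      Relation.ReflTransGen (fun a b : I.carrier => a ≤ b ∨ b ≤ a) p ⟨r, hr⟩ := by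
    intro r h
    induction h with
    | refl => exact fun _ => .refl
    | tail _ hbc ih => exact fun hr => (ih hbc.1).tail hbc.2.2
  exact key q.1 (I.connected p.2 q.2) q.2

variable (I : FinInterval (ℤ × ℤ))

/-- Together with the growth of the first coordinate, this puts a bound of both `p i` and `p j`
above every `p m` with `i ≤ m ≤ j`. -/
theorem minPt_snd_antitone : Antitone fun i => (minPt I i).2 := by
  intro i j hij
  by_contra hlt
  exact minElems_antichain _ _ (enumByX_mem _ _ (card_minElems I) i) _
    (enumByX_mem _ _ (card_minElems I) j)
    (Prod.lt_iff.2 (Or.inr ⟨(minPt_strictMono I).monotone hij, not_le.1 hlt⟩))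

theorem maxPt_snd_antitone : Antitone fun i => (maxPt I i).2 := by
  intro i j hij
  by_contra hlt
  exact maxElems_antichain _ _ (enumByX_mem _ _ (card_maxElems I) i) _
    (enumByX_mem _ _ (card_maxElems I) j)
    (Prod.lt_iff.2 (Or.inr ⟨(maxPt_strictMono I).monotone hij, not_le.1 hlt⟩))

theorem exists_minPt_le (r : I.carrier) : ∃ i, minPt I i ≤ r.1 := by
  obtain ⟨m, hm, hle⟩ := exists_minElems_le r.2
  obtain ⟨i, rfl⟩ := enumByX_surj _ _ (card_minElems I) hm
  exact ⟨i, hle⟩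

theorem exists_le_maxPt (r : I.carrier) : ∃ i, r.1 ≤ maxPt I i := by
  obtain ⟨m, hm, hle⟩ := exists_le_maxElems r.2
  obtain ⟨i, rfl⟩ := enumByX_surj _ _ (card_maxElems I) hm
  exact ⟨i, hle⟩

/-- The point at position `t` of the lower zigzag, read from left to right. -/
noncomputable def lowerPoint (t : Fin (2 * numMin I + 1)) : CapPoset I :=
  (⟨2 * numMin I - t, by omega⟩ : Fin _)

/-- The point at position `t` of the upper zigzag, read from left to right. -/
noncomputable def upperPoint (t : Fin (2 * numMax I + 1)) : CapPoset I :=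
  (⟨2 * numMin I + 1 + t, by omega⟩ : Fin _)

theorem capMap_lowerPoint (t : Fin (2 * numMin I + 1)) :
    (capMap I (lowerPoint I t)).1 = minZZ I t := by
  have ht := t.isLt
  change boundaryCap I _ = _
  have hpos : (lowerPoint I t).pos = 2 * numMin I - t := rfl
  rw [boundaryCap, dif_pos (by omega)]
  exact congrArg _ (Fin.ext (by dsimp only; omega))

theorem capMap_upperPoint (t : Fin (2 * numMax I + 1)) :
    (capMap I (upperPoint I t)).1 = maxZZ I t := by
  change boundaryCap I _ = _
  have hpos : (upperPoint I t).pos = 2 * numMin I + 1 + t := rfl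
  rw [boundaryCap, dif_neg (by omega)]
  exact congrArg _ (Fin.ext (by dsimp only; omega))

theorem lowerPoint_le {s t : Fin (2 * numMin I + 1)} (hs : Even s.val)
    (h : t.val = s.val + 1 ∨ s.val = t.val + 1) : lowerPoint I s ≤ lowerPoint I t := by
  have hs' := s.isLt
  have ht' := t.isLt
  have h1 : (lowerPoint I s).pos = 2 * numMin I - s := rfl
  have h2 : (lowerPoint I t).pos = 2 * numMin I - t := rfl
  rw [Nat.even_iff] at hs
  exact Or.inr ⟨Nat.even_iff.2 (by omega), by omega⟩

theorem upperPoint_le {s t : Fin (2 * numMax I + 1)} (ht : Even t.val)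
    (h : t.val = s.val + 1 ∨ s.val = t.val + 1) : upperPoint I s ≤ upperPoint I t := by
  have h1 : (upperPoint I s).pos = 2 * numMin I + 1 + s := rfl
  have h2 : (upperPoint I t).pos = 2 * numMin I + 1 + t := rfl
  rw [Nat.even_iff] at ht
  exact Or.inr ⟨Nat.even_iff.2 (by omega), by omega⟩

theorem lowerPoint_zero_le_upperPoint_zero : lowerPoint I 0 ≤ upperPoint I 0 :=
  Or.inr ⟨Nat.even_iff.2 (by change (2 * numMin I - 0) % 2 = 0; omega), Or.inl rfl⟩

theorem minZZ_two_mul (i : ℕ) (hi : 2 * i < 2 * numMin I + 1) :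
    minZZ I ⟨2 * i, hi⟩ = minPt I ⟨i, by omega⟩ := by
  have h1 : (⟨2 * i / 2, by omega⟩ : Fin (numMin I + 1)) = ⟨i, by omega⟩ :=
    Fin.ext (by dsimp only; omega)
  have h2 : (⟨(2 * i + 1) / 2, by omega⟩ : Fin (numMin I + 1)) = ⟨i, by omega⟩ :=
    Fin.ext (by dsimp only; omega)
  rw [minZZ, h1, h2, sup_idem]

theorem minZZ_two_mul_add_one (i : ℕ) (hi : 2 * i + 1 < 2 * numMin I + 1) :
    minZZ I ⟨2 * i + 1, hi⟩ = minPt I ⟨i, by omega⟩ ⊔ minPt I ⟨i + 1, by omega⟩ := by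
  have h1 : (⟨(2 * i + 1) / 2, by omega⟩ : Fin (numMin I + 1)) = ⟨i, by omega⟩ :=
    Fin.ext (by dsimp only; omega)
  have h2 : (⟨(2 * i + 1 + 1) / 2, by omega⟩ : Fin (numMin I + 1)) = ⟨i + 1, by omega⟩ :=
    Fin.ext (by dsimp only; omega)
  rw [minZZ, h1, h2]

theorem maxZZ_two_mul (i : ℕ) (hi : 2 * i < 2 * numMax I + 1) :
    maxZZ I ⟨2 * i, hi⟩ = maxPt I ⟨i, by omega⟩ := by
  have h1 : (⟨2 * i / 2, by omega⟩ : Fin (numMax I + 1)) = ⟨i, by omega⟩ :=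
    Fin.ext (by dsimp only; omega)
  have h2 : (⟨(2 * i + 1) / 2, by omega⟩ : Fin (numMax I + 1)) = ⟨i, by omega⟩ :=
    Fin.ext (by dsimp only; omega)
  rw [maxZZ, h1, h2, inf_idem]

theorem maxZZ_two_mul_add_one (i : ℕ) (hi : 2 * i + 1 < 2 * numMax I + 1) :
    maxZZ I ⟨2 * i + 1, hi⟩ = maxPt I ⟨i, by omega⟩ ⊓ maxPt I ⟨i + 1, by omega⟩ := by
  have h1 : (⟨(2 * i + 1) / 2, by omega⟩ : Fin (numMax I + 1)) = ⟨i, by omega⟩ :=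
    Fin.ext (by dsimp only; omega)
  have h2 : (⟨(2 * i + 1 + 1) / 2, by omega⟩ : Fin (numMax I + 1)) = ⟨i + 1, by omega⟩ :=
    Fin.ext (by dsimp only; omega)
  rw [maxZZ, h1, h2]

variable {𝔽 : Type u} [Field 𝔽] (M : I.carrier ⥤ FGModuleCat.{u} 𝔽)

/-! ### Extending sections and cosections from the cap to the interval. -/

section Sections

variable {s : ∀ x, (boundaryModule I M).obj x} (hs : IsSection (boundaryModule I M) Set.univ s)

include hs

theorem transition_section_boundary {x y : CapPoset I} (h : x ≤ y) {r : I.carrier}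
    (hx : capMap I x ≤ r) (hy : capMap I y ≤ r) :
    transition M hx (s x) = transition M hy (s y) := by
  rw [← hs h trivial trivial]
  exact (transition_trans M ((capMap I).monotone h) hy (s x)).symm

/-- Every minimal point between the two is also below `r`, and so is each join of neighbours. At
such a join the two transported values agree because `s` is a section, so one can walk from index
`i` to index `i + d`. -/
theorem transition_section_lowerPoint (r : I.carrier) (i d : ℕ)
    (hi : 2 * i < 2 * numMin I + 1) (hj : 2 * (i + d) < 2 * numMin I + 1)
    (h : capMap I (lowerPoint I ⟨2 * i, hi⟩) ≤ r)
    (h' : capMap I (lowerPoint I ⟨2 * (i + d), hj⟩) ≤ r) :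
    transition M h (s (lowerPoint I ⟨2 * i, hi⟩)) =
      transition M h' (s (lowerPoint I ⟨2 * (i + d), hj⟩)) := by
  induction d with
  | zero => rfl
  | succ d ih =>
    have e1 : minPt I ⟨i, by omega⟩ ≤ r.1 := by
      rw [← minZZ_two_mul I i hi, ← capMap_lowerPoint]; exact h
    have e2 : minPt I ⟨i + (d + 1), by omega⟩ ≤ r.1 := by
      rw [← minZZ_two_mul I _ hj, ← capMap_lowerPoint]; exact h'
    have e3 : minPt I ⟨i + d, by omega⟩ ≤ r.1 :=
      ⟨((minPt_strictMono I).monotone (Fin.mk_le_mk.2 (by omega))).trans e2.1,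
        (minPt_snd_antitone I (Fin.mk_le_mk.2 (by omega))).trans e1.2⟩
    have hm : 2 * (i + d) < 2 * numMin I + 1 := by omega
    have hm' : 2 * (i + d) + 1 < 2 * numMin I + 1 := by omega
    have e4 : capMap I (lowerPoint I ⟨2 * (i + d), hm⟩) ≤ r := by
      rw [← Subtype.coe_le_coe, capMap_lowerPoint, minZZ_two_mul]; exact e3
    have e5 : capMap I (lowerPoint I ⟨2 * (i + d) + 1, hm'⟩) ≤ r := by
      rw [← Subtype.coe_le_coe, capMap_lowerPoint, minZZ_two_mul_add_one]; exact sup_le e3 e2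
    rw [ih hm e4]
    exact (transition_section_boundary I M hs (lowerPoint_le I
      (Nat.even_iff.2 (by dsimp only; omega)) (Or.inl rfl)) e4 e5).trans
      (transition_section_boundary I M hs (lowerPoint_le I
      (Nat.even_iff.2 (by dsimp only; omega)) (Or.inr (by dsimp only; omega))) h' e5).symm

/-- The value at the leftmost minimal point of a section along the boundary cap is the value of a
section of the whole module. -/
theorem exists_section_extending :
    ∃ s' : ∀ r, M.obj r, IsSection M Set.univ s' ∧
      s' (capMap I (lowerPoint I 0)) = s (lowerPoint I 0) := by
  have hex : ∀ r : I.carrier, ∃ (i : ℕ) (hi : 2 * i < 2 * numMin I + 1),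
      capMap I (lowerPoint I ⟨2 * i, hi⟩) ≤ r := by
    intro r
    obtain ⟨i, hi⟩ := exists_minPt_le I r
    refine ⟨i, by omega, ?_⟩
    rw [← Subtype.coe_le_coe, capMap_lowerPoint, minZZ_two_mul]
    exact hi
  have hwd : ∀ (r : I.carrier) (i j : ℕ) (hi : 2 * i < 2 * numMin I + 1)
      (hj : 2 * j < 2 * numMin I + 1) (h : capMap I (lowerPoint I ⟨2 * i, hi⟩) ≤ r)
      (h' : capMap I (lowerPoint I ⟨2 * j, hj⟩) ≤ r),
      transition M h (s (lowerPoint I ⟨2 * i, hi⟩)) =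
        transition M h' (s (lowerPoint I ⟨2 * j, hj⟩)) := by
    intro r i j hi hj h h'
    rcases Nat.le_total i j with hij | hij
    · obtain ⟨d, rfl⟩ := Nat.exists_eq_add_of_le hij
      exact transition_section_lowerPoint I M hs r i d hi hj h h'
    · obtain ⟨d, rfl⟩ := Nat.exists_eq_add_of_le hij
      exact (transition_section_lowerPoint I M hs r j d hj hi h' h).symm
  choose i hi hle using hex
  -- The minimal point chosen below each `r` is arbitrary; `hwd` makes the value independent of it,
  -- which yields both compatibility and the value at `p 0`.
  refine ⟨fun r => transition M (hle r) (s _), ?_, ?_⟩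
  · intro p q h _ _
    exact (transition_trans M (hle p) h _).trans (hwd q _ _ _ _ _ _)
  · exact (hwd _ _ 0 _ (by omega) _ le_rfl).trans (transition_refl _ _ _)

end Sections

section Cosections

variable {φ : ∀ x, (boundaryModule I M).obj x →ₗ[𝔽] 𝔽}
  (hφ : IsCosection (boundaryModule I M) Set.univ φ)

include hφ

theorem cosection_boundary_transition {x y : CapPoset I} (h : x ≤ y) {r : I.carrier}
    (hx : r ≤ capMap I x) (hy : r ≤ capMap I y) :
    φ x ∘ₗ transition M hx = φ y ∘ₗ transition M hy := by
  rw [← hφ h trivial trivial]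
  ext v
  exact congrArg (φ y) (transition_trans M hx ((capMap I).monotone h) v)

/-- Dual walk: the maximal points above `r` have consecutive indices, and the functionals of
neighbours agree on their meet, which is above `r`. -/
theorem cosection_upperPoint_transition (r : I.carrier) (i d : ℕ)
    (hi : 2 * i < 2 * numMax I + 1) (hj : 2 * (i + d) < 2 * numMax I + 1)
    (h : r ≤ capMap I (upperPoint I ⟨2 * i, hi⟩))
    (h' : r ≤ capMap I (upperPoint I ⟨2 * (i + d), hj⟩)) :
    φ (upperPoint I ⟨2 * i, hi⟩) ∘ₗ transition M h =
      φ (upperPoint I ⟨2 * (i + d), hj⟩) ∘ₗ transition M h' := by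
  induction d with
  | zero => rfl
  | succ d ih =>
    have e1 : r.1 ≤ maxPt I ⟨i, by omega⟩ := by
      rw [← maxZZ_two_mul I i hi, ← capMap_upperPoint]; exact h
    have e2 : r.1 ≤ maxPt I ⟨i + (d + 1), by omega⟩ := by
      rw [← maxZZ_two_mul I _ hj, ← capMap_upperPoint]; exact h'
    have e3 : r.1 ≤ maxPt I ⟨i + d, by omega⟩ :=
      ⟨e1.1.trans ((maxPt_strictMono I).monotone (Fin.mk_le_mk.2 (by omega))),
        e2.2.trans (maxPt_snd_antitone I (Fin.mk_le_mk.2 (by omega)))⟩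
    have hm : 2 * (i + d) < 2 * numMax I + 1 := by omega
    have hm' : 2 * (i + d) + 1 < 2 * numMax I + 1 := by omega
    have e4 : r ≤ capMap I (upperPoint I ⟨2 * (i + d), hm⟩) := by
      rw [← Subtype.coe_le_coe, capMap_upperPoint, maxZZ_two_mul]; exact e3
    have e5 : r ≤ capMap I (upperPoint I ⟨2 * (i + d) + 1, hm'⟩) := by
      rw [← Subtype.coe_le_coe, capMap_upperPoint, maxZZ_two_mul_add_one]; exact le_inf e3 e2
    rw [ih hm e4]
    exact (cosection_boundary_transition I M hφ (upperPoint_le I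
      (Nat.even_iff.2 (by dsimp only; omega)) (Or.inr rfl)) e5 e4).symm.trans
      (cosection_boundary_transition I M hφ (upperPoint_le I
      (Nat.even_iff.2 (by dsimp only; omega)) (Or.inl (by dsimp only; omega))) e5 h')

/-- The functional at the leftmost maximal point of a cosection along the boundary cap belongs to a
cosection of the whole module. -/
theorem exists_cosection_extending :
    ∃ φ' : ∀ r, M.obj r →ₗ[𝔽] 𝔽, IsCosection M Set.univ φ' ∧
      φ' (capMap I (upperPoint I 0)) = φ (upperPoint I 0) := by
  have hex : ∀ r : I.carrier, ∃ (i : ℕ) (hi : 2 * i < 2 * numMax I + 1),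
      r ≤ capMap I (upperPoint I ⟨2 * i, hi⟩) := by
    intro r
    obtain ⟨i, hi⟩ := exists_le_maxPt I r
    refine ⟨i, by omega, ?_⟩
    rw [← Subtype.coe_le_coe, capMap_upperPoint, maxZZ_two_mul]
    exact hi
  have hwd : ∀ (r : I.carrier) (i j : ℕ) (hi : 2 * i < 2 * numMax I + 1)
      (hj : 2 * j < 2 * numMax I + 1) (h : r ≤ capMap I (upperPoint I ⟨2 * i, hi⟩))
      (h' : r ≤ capMap I (upperPoint I ⟨2 * j, hj⟩)),
      φ (upperPoint I ⟨2 * i, hi⟩) ∘ₗ transition M h =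
        φ (upperPoint I ⟨2 * j, hj⟩) ∘ₗ transition M h' := by
    intro r i j hi hj h h'
    rcases Nat.le_total i j with hij | hij
    · obtain ⟨d, rfl⟩ := Nat.exists_eq_add_of_le hij
      exact cosection_upperPoint_transition I M hφ r i d hi hj h h'
    · obtain ⟨d, rfl⟩ := Nat.exists_eq_add_of_le hij
      exact (cosection_upperPoint_transition I M hφ r j d hj hi h' h).symm
  choose i hi hle using hex
  refine ⟨fun r => φ _ ∘ₗ transition M (hle r), ?_, ?_⟩
  · intro p q h _ _
    refine Eq.trans ?_ (hwd p _ _ (hi q) (hi p) (h.trans (hle q)) (hle p))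
    ext v
    exact congrArg (φ _) (transition_trans M h (hle q) v)
  · refine (hwd _ _ 0 _ (by omega) _ le_rfl).trans ?_
    ext v
    exact congrArg (φ _) (transition_refl M _ v)

end Cosections

/-- Restriction along `capMap` preserves sections and cosections, and the two extension theorems
give the converse at `p 0` and `q 0`. There both modules have the same spaces, so the values of the
limits and the kernels towards the colimits can be compared inside them. -/
theorem generalizedRank_boundaryModule :
    generalizedRank M (capMap I (lowerPoint I 0)) =
      generalizedRank (boundaryModule I M) (lowerPoint I 0) := by
  have hle := lowerPoint_zero_le_upperPoint_zero I
  rw [generalizedRank_eq_finrank_map M ((capMap I).monotone hle),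
    generalizedRank_eq_finrank_map (boundaryModule I M) hle]
  have hE : LinearMap.range (limit.π M (capMap I (lowerPoint I 0))).hom.hom =
      LinearMap.range (limit.π (boundaryModule I M) (lowerPoint I 0)).hom.hom := by
    ext v
    rw [mem_range_limit_π_iff]
    refine Iff.trans ?_ (mem_range_limit_π_iff (boundaryModule I M) v).symm
    constructor
    · rintro ⟨s, hs, hv⟩
      exact ⟨fun x => s (capMap I x), fun p q h _ _ => hs ((capMap I).monotone h) trivial trivial,
        hv⟩
    · rintro ⟨s, hs, hv⟩
      obtain ⟨s', hs', h⟩ := exists_section_extending I M hs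
      exact ⟨s', hs', h.trans hv⟩
  rw [hE]
  refine finrank_map_eq_of_ker_eq (V := M.obj (capMap I (lowerPoint I 0))) _ _ _ fun v => ?_
  refine (colimit_ι_eq_zero_iff M _).trans (Iff.trans ?_
    (colimit_ι_eq_zero_iff (boundaryModule I M) (p := upperPoint I 0) _).symm)
  constructor
  · intro H φ hφ
    obtain ⟨φ', hφ', h⟩ := exists_cosection_extending I M hφ
    exact (LinearMap.congr_fun h _).symm.trans (H φ' hφ')
  · intro H φ hφ
    exact H (fun x => φ (capMap I x)) fun p q h _ _ => hφ ((capMap I).monotone h) trivial trivial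

end ZigzagRank

namespace ZigzagRank

/-! ### Splitting off interval modules -/

section Generators

variable {𝔽 : Type u} [Field 𝔽] {P : Type} [PartialOrder P]

/-- The module has finitely many sections over intervals, extended by zero, whose values at the
points of their intervals form a basis at every point. -/
def HasIntervalBasis (M : P ⥤ FGModuleCat.{u} 𝔽) : Prop :=
  ∃ (n : ℕ) (J : Fin n → FinInterval P) (s : Fin n → ∀ p, M.obj p),
    (∀ i p, p ∉ (J i).carrier → s i p = 0) ∧
    (∀ i ⦃p q⦄ (h : p ≤ q), p ∈ (J i).carrier → transition M h (s i p) = s i q) ∧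
    ∀ p v, ∃! c : Fin n → 𝔽, (∀ i, p ∉ (J i).carrier → c i = 0) ∧ v = ∑ i, c i • s i p

theorem HasIntervalBasis.exists_isBarcode [Finite P] {M : P ⥤ FGModuleCat.{u} 𝔽}
    (hM : HasIntervalBasis M) : ∃ B, IsBarcode M B := by
  classical
  obtain ⟨n, J, s, hs0, hs, hb⟩ := hM
  refine ⟨_, n, J, rfl, ?_⟩
  -- Coordinates are extended by zero outside their intervals, so that one index set `Fin n` serves
  -- all points.
  let ext : ∀ p, (directSum fun i => intervalModule 𝔽 (J i)).obj p →ₗ[𝔽] (Fin n → 𝔽) := fun p =>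
    LinearMap.pi fun i => if h : p ∈ (J i).carrier then
      LinearMap.proj ⟨h⟩ ∘ₗ LinearMap.proj i ∘ₗ (intervalCoord J p).toLinearMap else 0
  have ext_mem : ∀ p v i (h : p ∈ (J i).carrier), ext p v i = intervalCoord J p v i ⟨h⟩ := by
    intro p v i h
    simp [ext, h]
  have ext_notMem : ∀ p v i, p ∉ (J i).carrier → ext p v i = 0 := by
    intro p v i h
    simp [ext, h]
  let Φ : ∀ p, (directSum fun i => intervalModule 𝔽 (J i)).obj p →ₗ[𝔽] M.obj p := fun p =>
    Fintype.linearCombination 𝔽 (fun i => s i p) ∘ₗ ext p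
  have Φ_apply : ∀ p v, Φ p v = ∑ i, ext p v i • s i p := fun p v => rfl
  have hbij : ∀ p, Function.Bijective (Φ p) := by
    intro p
    constructor
    · intro v w hvw
      have h1 := (hb p (Φ p v)).unique ⟨ext_notMem p v, Φ_apply p v⟩
        ⟨ext_notMem p w, hvw.trans (Φ_apply p w)⟩
      apply (intervalCoord J p).injective
      funext i hp
      have := congrFun h1 i
      rwa [ext_mem p v i hp.down, ext_mem p w i hp.down] at this
    · intro v
      obtain ⟨c, ⟨hc, hv⟩, -⟩ := hb p v
      refine ⟨(intervalCoord J p).symm fun i _ => c i, ?_⟩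
      rw [hv, Φ_apply]
      refine Finset.sum_congr rfl fun i _ => ?_
      by_cases h : p ∈ (J i).carrier
      · rw [ext_mem _ _ _ h, LinearEquiv.apply_symm_apply]
      · rw [ext_notMem _ _ _ h, hc i h]
  have hnat : ∀ {p q : P} (h : p ≤ q) v, Φ q (transition _ h v) = transition M h (Φ p v) := by
    intro p q h v
    rw [Φ_apply, Φ_apply, map_sum]
    refine Finset.sum_congr rfl fun i _ => ?_
    rw [map_smul]
    by_cases hp : p ∈ (J i).carrier
    · rw [hs i h hp]
      by_cases hq : q ∈ (J i).carrier
      · rw [ext_mem _ _ _ hp, ext_mem _ _ _ hq, intervalCoord_transition_of_mem J h _ hp]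
      · rw [hs0 i q hq, smul_zero, smul_zero]
    · rw [ext_notMem _ _ _ hp, zero_smul]
      by_cases hq : q ∈ (J i).carrier
      · rw [ext_mem _ _ _ hq, intervalCoord_transition_of_notMem J h _ hp, zero_smul]
      · rw [ext_notMem _ _ _ hq, zero_smul]
  exact ⟨(NatIso.ofComponents
    (fun p => (LinearEquiv.ofBijective (Φ p) (hbij p)).toFGModuleCatIso)
    (by
      intro p q f
      apply FGModuleCat.hom_ext
      apply LinearMap.ext
      intro v
      exact hnat (leOfHom f) v)).symm⟩

/-- The persistence module of the kernels of a compatible family of functionals. -/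
noncomputable def kernelModule (M : P ⥤ FGModuleCat.{u} 𝔽) (φ : ∀ p, M.obj p →ₗ[𝔽] 𝔽)
    (h : ∀ ⦃p q : P⦄ (h : p ≤ q) v, φ p v = 0 → φ q (transition M h v) = 0) :
    P ⥤ FGModuleCat.{u} 𝔽 where
  obj p := FGModuleCat.of 𝔽 (LinearMap.ker (φ p))
  map f := FGModuleCat.ofHom ((transition M (leOfHom f)).restrict fun v hv => h (leOfHom f) v hv)
  map_id p := by
    apply FGModuleCat.hom_ext
    apply LinearMap.ext
    intro v
    exact Subtype.ext (transition_refl M p v.1)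
  map_comp f g := by
    apply FGModuleCat.hom_ext
    apply LinearMap.ext
    intro v
    exact Subtype.ext (transition_trans M (leOfHom f) (leOfHom g) v.1).symm

/-- If a section over an interval and a cosection pair to `1`, the interval module splits off. -/
theorem HasIntervalBasis.of_kernelModule {M : P ⥤ FGModuleCat.{u} 𝔽} {φ : ∀ p, M.obj p →ₗ[𝔽] 𝔽}
    (h : ∀ ⦃p q : P⦄ (h : p ≤ q) v, φ p v = 0 → φ q (transition M h v) = 0)
    (J : FinInterval P) (s : ∀ p, M.obj p) (hs0 : ∀ p, p ∉ J.carrier → s p = 0)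
    (hs : ∀ ⦃p q⦄ (h : p ≤ q), p ∈ J.carrier → transition M h (s p) = s q)
    (hφ0 : ∀ p, p ∉ J.carrier → φ p = 0) (hφs : ∀ p, p ∈ J.carrier → φ p (s p) = 1)
    (hK : HasIntervalBasis (kernelModule M φ h)) : HasIntervalBasis M := by
  obtain ⟨n, J', s', hs0', hs', hb'⟩ := hK
  let val : ∀ p, (kernelModule M φ h).obj p →ₗ[𝔽] M.obj p := fun p => (LinearMap.ker (φ p)).subtype
  have φ_val : ∀ p v, φ p (val p v) = 0 := fun p v => v.2
  have val_inj : ∀ p, Function.Injective (val p) := fun p => Subtype.val_injective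
  refine ⟨n + 1, Fin.cons J J', Fin.cons s fun i p => val p (s' i p), ?_, ?_, ?_⟩
  · intro i p hp
    cases i using Fin.cases with
    | zero => exact hs0 p hp
    | succ i => exact (congrArg (val p) (hs0' i p hp)).trans (map_zero _)
  · intro i p q hpq hp
    cases i using Fin.cases with
    | zero => exact hs hpq hp
    | succ i => exact congrArg (val q) (hs' i hpq hp)
  · intro p v
    -- Projection to the kernel along `s p`; outside `J` the functional is zero and nothing has to
    -- be removed.
    have hmem : φ p (v - φ p v • s p) = 0 := by
      by_cases hp : p ∈ J.carrier
      · rw [map_sub, map_smul, hφs p hp, smul_eq_mul, mul_one, sub_self]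
      · rw [hφ0 p hp]; rfl
    obtain ⟨c, ⟨hc0, hc⟩, huniq⟩ := hb' p ⟨v - φ p v • s p, hmem⟩
    have hsum : ∀ c' : Fin n → 𝔽, val p (∑ i, c' i • s' i p) = ∑ i, c' i • val p (s' i p) := by
      intro c'
      rw [map_sum]
      exact Finset.sum_congr rfl fun i _ => map_smul _ _ _
    refine ⟨Fin.cons (φ p v) c, ⟨?_, ?_⟩, ?_⟩
    · intro i hp
      cases i using Fin.cases with
      | zero => exact LinearMap.congr_fun (hφ0 p hp) v
      | succ i => exact hc0 i hp
    · rw [Fin.sum_univ_succ]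
      simp only [Fin.cons_zero, Fin.cons_succ]
      rw [← hsum, ← hc]
      exact (add_sub_cancel _ v).symm
    · rintro d ⟨hd0, hd⟩
      rw [Fin.sum_univ_succ] at hd
      simp only [Fin.cons_zero, Fin.cons_succ] at hd
      rw [← hsum fun i => d i.succ] at hd
      -- Applying `φ p` isolates the coefficient of `s p`, as the other generators lie in the
      -- kernel. Outside `J` both sides vanish.
      have hd1 : d 0 = φ p v := by
        by_cases hp : p ∈ J.carrier
        · rw [hd, map_add, map_smul, hφs p hp, φ_val, add_zero, smul_eq_mul, mul_one]
        · rw [hφ0 p hp]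
          exact hd0 0 hp
      have hd2 : (fun i => d i.succ) = c := by
        refine huniq _ ⟨fun i hp => hd0 i.succ hp, val_inj p ?_⟩
        change v - φ p v • s p = _
        rw [← hd1, sub_eq_iff_eq_add']
        exact hd
      rw [← hd1, ← hd2]
      exact (Fin.cons_self_tail d).symm

end Generators

end ZigzagRank

namespace ZigzagRank

/-! ### Modules over zigzag posets -/

/-- The point of a zigzag poset at a given position. -/
def Zigzag.point {n : ℕ} (t : ℕ) (h : t < n) : Zigzag n := (⟨t, h⟩ : Fin n)

theorem Zigzag.ext_pos {n : ℕ} {x y : Zigzag n} (h : x.pos = y.pos) : x = y := Fin.ext h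

open Classical in
/-- A segment of a zigzag poset as a finite interval. -/
noncomputable def Zigzag.segmentInterval {n a b : ℕ} (ha : a < n) (hab : a ≤ b) :
    FinInterval (Zigzag n) where
  carrier := {x | x ∈ segment n a b}
  nonempty := ⟨point a ha, by simpa using ⟨le_rfl, hab⟩⟩
  convex := by
    intro p q r hp hq hpr hrq
    rcases le_def.1 hpr with rfl | ⟨h1, h2⟩
    · exact hp
    · rcases le_def.1 hrq with rfl | ⟨h3, h4⟩
      · exact hq
      · rw [Nat.even_iff] at h1 h3
        omega
  connected := by
    intro p q hp hq
    simp only [Finset.mem_filter_univ] at hp hq ⊢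
    exact segment_chain hp hq

theorem Zigzag.mem_segmentInterval {n a b : ℕ} (ha : a < n) (hab : a ≤ b) {x : Zigzag n} :
    x ∈ (segmentInterval ha hab).carrier ↔ x ∈ segment n a b := by
  simp [segmentInterval]

variable {𝔽 : Type u} [Field 𝔽] {n : ℕ} {M : Zigzag n ⥤ FGModuleCat.{u} 𝔽}

open Zigzag

theorem eq_of_mem_segment_succ {a b : ℕ} (hb : b + 1 < n) {x : Zigzag n}
    (hx : x ∈ segment n a (b + 1)) (hne : x ≠ point (b + 1) hb) : x ∈ segment n a b := by
  refine ⟨hx.1, Nat.lt_succ_iff.1 (lt_of_le_of_ne hx.2 fun h => hne (ext_pos h))⟩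

theorem eq_point_of_le {b : ℕ} {hb : b + 1 < n} {x : Zigzag n} (hx : x.pos ≤ b)
    (h : x ≤ point (b + 1) hb ∨ point (b + 1) hb ≤ x) :
    x = point b (Nat.lt_of_succ_lt hb) := by
  have hpos : (point (b + 1) hb).pos = b + 1 := rfl
  apply ext_pos
  change x.pos = b
  rcases h with h | h <;> rcases le_def.1 h with h | ⟨-, h⟩
  · rw [h] at hx; omega
  · omega
  · rw [← h] at hx; omega
  · omega

/-- The parity of `b` decides the direction of the new arrow, so exactly one of `h1` and `h2` has
content. -/
theorem isSection_update {a b : ℕ} (hb : b + 1 < n) {s : ∀ x, M.obj x}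
    (hs : IsSection M (segment n a b) s) (v : M.obj (point (b + 1) hb))
    (h1 : ∀ h : point b (Nat.lt_of_succ_lt hb) ≤ point (b + 1) hb, transition M h (s _) = v)
    (h2 : ∀ h : point (b + 1) hb ≤ point b (Nat.lt_of_succ_lt hb), transition M h v = s _) :
    IsSection M (segment n a (b + 1)) (Function.update s (point (b + 1) hb) v) := by
  intro p q h hp hq
  by_cases hpe : p = point (b + 1) hb
  · subst hpe
    by_cases hqe : q = point (b + 1) hb
    · subst hqe
      exact transition_refl M _ _
    · rw [Function.update_self, Function.update_of_ne hqe]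
      obtain rfl := eq_point_of_le (eq_of_mem_segment_succ hb hq hqe).2 (Or.inr h)
      exact h2 h
  · rw [Function.update_of_ne hpe]
    have hp' := eq_of_mem_segment_succ hb hp hpe
    by_cases hqe : q = point (b + 1) hb
    · subst hqe
      rw [Function.update_self]
      obtain rfl := eq_point_of_le hp'.2 (Or.inl h)
      exact h1 h
    · rw [Function.update_of_ne hqe]
      exact hs h hp' (eq_of_mem_segment_succ hb hq hqe)

theorem isCosection_update {a b : ℕ} (hb : b + 1 < n) {φ : ∀ x, M.obj x →ₗ[𝔽] 𝔽}
    (hφ : IsCosection M (segment n a b) φ) (ψ : M.obj (point (b + 1) hb) →ₗ[𝔽] 𝔽)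
    (h1 : ∀ h : point b (Nat.lt_of_succ_lt hb) ≤ point (b + 1) hb, ψ ∘ₗ transition M h = φ _)
    (h2 : ∀ h : point (b + 1) hb ≤ point b (Nat.lt_of_succ_lt hb), φ _ ∘ₗ transition M h = ψ) :
    IsCosection M (segment n a (b + 1)) (Function.update φ (point (b + 1) hb) ψ) := by
  intro p q h hp hq
  by_cases hpe : p = point (b + 1) hb
  · subst hpe
    by_cases hqe : q = point (b + 1) hb
    · subst hqe
      ext v
      exact congrArg _ (transition_refl M _ v)
    · rw [Function.update_self, Function.update_of_ne hqe]
      obtain rfl := eq_point_of_le (eq_of_mem_segment_succ hb hq hqe).2 (Or.inr h)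
      exact h2 h
  · rw [Function.update_of_ne hpe]
    have hp' := eq_of_mem_segment_succ hb hp hpe
    by_cases hqe : q = point (b + 1) hb
    · subst hqe
      rw [Function.update_self]
      obtain rfl := eq_point_of_le hp'.2 (Or.inl h)
      exact h1 h
    · rw [Function.update_of_ne hqe]
      exact hφ h hp' (eq_of_mem_segment_succ hb hq hqe)

theorem IsSection.mono {P : Type} [PartialOrder P] {M : P ⥤ FGModuleCat.{u} 𝔽} {S T : Set P}
    {s : ∀ p, M.obj p} (hs : IsSection M T s) (h : S ⊆ T) : IsSection M S s :=
  fun _ _ hpq hp hq => hs hpq (h hp) (h hq)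

theorem isSection_segment_self {a : ℕ} (s : ∀ x, M.obj x) : IsSection M (segment n a a) s := by
  intro p q h hp hq
  obtain rfl : p = q := ext_pos ((le_antisymm hp.2 hp.1).trans (le_antisymm hq.1 hq.2))
  exact transition_refl M _ _

theorem isCosection_segment_self {a : ℕ} (φ : ∀ x, M.obj x →ₗ[𝔽] 𝔽) :
    IsCosection M (segment n a a) φ := by
  intro p q h hp hq
  obtain rfl : p = q := ext_pos ((le_antisymm hp.2 hp.1).trans (le_antisymm hq.1 hq.2))
  ext v
  exact congrArg _ (transition_refl M _ v)

/-- `φ` vanishes on the kernel of `V → W ⧸ U`, hence factors through that map. -/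
theorem exists_functional_comp_eq {V W : Type*} [AddCommGroup V] [Module 𝔽 V] [AddCommGroup W]
    [Module 𝔽 W] (f : V →ₗ[𝔽] W) (U : Submodule 𝔽 W) (φ : V →ₗ[𝔽] 𝔽)
    (h : ∀ v, f v ∈ U → φ v = 0) : ∃ ψ : W →ₗ[𝔽] 𝔽, ψ ∘ₗ f = φ ∧ ∀ u ∈ U, ψ u = 0 := by
  have hφ : φ ∈ LinearMap.range (U.mkQ ∘ₗ f).dualMap := by
    rw [LinearMap.range_dualMap_eq_dualAnnihilator_ker, Submodule.mem_dualAnnihilator]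
    intro v hv
    exact h v (by simpa using hv)
  obtain ⟨g, hg⟩ := hφ
  exact ⟨g ∘ₗ U.mkQ, hg, fun u hu => by simp [(Submodule.Quotient.mk_eq_zero U).2 hu]⟩

/-- A functional at the first point of a segment extends to a cosection whose last member vanishes
on `U` if it vanishes at the sections that end in `U`. -/
theorem exists_isCosection_segment {a : ℕ} (ha : a < n) (φ₀ : M.obj (point a ha) →ₗ[𝔽] 𝔽)
    {b : ℕ} (hab : a ≤ b) (hb : b < n) (U : Submodule 𝔽 (M.obj (point b hb)))
    (h : ∀ s, IsSection M (segment n a b) s → s (point b hb) ∈ U → φ₀ (s (point a ha)) = 0) :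
    ∃ φ, IsCosection M (segment n a b) φ ∧ φ (point a ha) = φ₀ ∧ ∀ u ∈ U, φ (point b hb) u = 0 := by
  induction b, hab using Nat.le_induction with
  | base =>
    refine ⟨Function.update 0 (point a ha) φ₀, isCosection_segment_self _, Function.update_self ..,
      fun u hu => ?_⟩
    rw [Function.update_self]
    have := h (Function.update 0 (point a ha) u) (isSection_segment_self _)
    rw [Function.update_self] at this
    exact this hu
  | succ b hab ih =>
    have hb' := Nat.lt_of_succ_lt hb
    have hne : point a ha ≠ point (b + 1) hb := fun h => by
      have : a = b + 1 := congrArg pos h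
      omega
    have hne' : point b hb' ≠ point (b + 1) hb := fun h => by
      have : b = b + 1 := congrArg pos h
      omega
    rcases Nat.even_or_odd b with hev | hodd
    · have hle : point b hb' ≤ point (b + 1) hb := Or.inr ⟨hev, Or.inl rfl⟩
      have hnle : ¬ point (b + 1) hb ≤ point b hb' := fun h => hne' (le_antisymm hle h)
      -- A section that ends in the preimage of `U` continues into `U`, so the hypothesis descends
      -- to `b` with the preimage.
      obtain ⟨φ, hφ, hφa, hφU⟩ := ih hb' (U.comap (transition M hle)) (by
        intro s hs hsU
        have := h _ (isSection_update hb hs (transition M hle (s _)) (fun _ => rfl)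
          fun h => absurd h hnle)
        rw [Function.update_self, Function.update_of_ne hne] at this
        exact this hsU)
      obtain ⟨ψ, hψ, hψU⟩ := exists_functional_comp_eq (transition M hle) U (φ (point b hb'))
        fun v hv => hφU v hv
      refine ⟨Function.update φ (point (b + 1) hb) ψ,
        isCosection_update hb hφ ψ (fun _ => hψ) fun h => absurd h hnle, ?_, ?_⟩
      · rw [Function.update_of_ne hne, hφa]
      · rw [Function.update_self]
        exact hψU
    · have hle : point (b + 1) hb ≤ point b hb' := Or.inr ⟨hodd.add_one, Or.inr rfl⟩
      have hnle : ¬ point b hb' ≤ point (b + 1) hb := fun h => hne' (le_antisymm h hle)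
      -- Against the arrow, a section continues into `U` exactly if it ends in the image of `U`.
      obtain ⟨φ, hφ, hφa, hφU⟩ := ih hb' (U.map (transition M hle)) (by
        rintro s hs ⟨u, hu, hus⟩
        have := h _ (isSection_update hb hs u (fun h => absurd h hnle) fun _ => hus)
        rw [Function.update_self, Function.update_of_ne hne] at this
        exact this hu)
      refine ⟨Function.update φ (point (b + 1) hb) (φ (point b hb') ∘ₗ transition M hle),
        isCosection_update hb hφ _ (fun h => absurd h hnle) fun _ => rfl, ?_, ?_⟩
      · rw [Function.update_of_ne hne, hφa]
      · rw [Function.update_self]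
        exact fun u hu => hφU _ ⟨u, hu, rfl⟩

/-- A section over a segment that starts with a nonzero vector at `a` leaves the segment through
zero maps, and is paired nontrivially with a cosection that vanishes on what enters the segment. -/
theorem exists_section_cosection_segment {a : ℕ} (ha : a < n) (v : M.obj (point a ha))
    (hv : v ≠ 0) : ∃ (b : ℕ) (_ : a ≤ b) (hb : b < n) (s : ∀ x, M.obj x)
      (φ : ∀ x, M.obj x →ₗ[𝔽] 𝔽), IsSection M (segment n a b) s ∧
      IsCosection M (segment n a b) φ ∧ φ (point a ha) (s (point a ha)) = 1 ∧
      (∀ (hb' : b + 1 < n) (h : point b hb ≤ point (b + 1) hb'), transition M h (s _) = 0) ∧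
      ∀ (hb' : b + 1 < n) (h : point (b + 1) hb' ≤ point b hb), φ _ ∘ₗ transition M h = 0 := by
  classical
  -- `R b` says that a nonzero vector at `a` can be continued to `b`, and `K b` that this is
  -- possible with value zero at `b`. Without `K b`, the value at `b` determines the value at `a`.
  -- The segment ends at some `b` that is good while `b + 1` is not.
  let R : ℕ → Prop := fun b => ∃ s, IsSection M (segment n a b) s ∧ s (point a ha) ≠ 0
  let K : ℕ → Prop := fun b => ∃ (hb : b < n) (s : _), IsSection M (segment n a b) s ∧
    s (point a ha) ≠ 0 ∧ s (point b hb) = 0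
  let good : ℕ → Prop := fun b => a ≤ b ∧ b < n ∧ R b ∧ ¬ K b
  have hgood : good a := by
    refine ⟨le_rfl, ha, ⟨Function.update 0 (point a ha) v, isSection_segment_self _, ?_⟩, ?_⟩
    · rwa [Function.update_self]
    · rintro ⟨_, s, -, h1, h2⟩
      exact h1 h2
  obtain ⟨b, ⟨hab, hb, ⟨s, hs, hsa⟩, hK⟩, hmax⟩ : ∃ b, good b ∧ ¬ good (b + 1) := by
    by_contra! hcon
    have hall : ∀ d, good (a + d) := fun d => by
      induction d with
      | zero => exact hgood
      | succ d ih => exact hcon _ ih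
    have := (hall n).2.1
    omega
  have hK' : ∀ s, IsSection M (segment n a b) s → s (point b hb) = 0 → s (point a ha) = 0 := by
    intro s hs h0
    by_contra hne
    exact hK ⟨hb, s, hs, hne, h0⟩
  have hbot : ∀ s, IsSection M (segment n a b) s → s (point a ha) ≠ 0 →
      ∃ φ, IsCosection M (segment n a b) φ ∧ φ (point a ha) (s (point a ha)) = 1 := by
    intro s hs hsa
    obtain ⟨φ₀, hφ₀⟩ := Module.Projective.exists_dual_eq_one 𝔽 hsa
    obtain ⟨φ, hφ, hφa, -⟩ := exists_isCosection_segment ha φ₀ hab hb ⊥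
      fun s hs h0 => by rw [hK' s hs h0, map_zero]
    exact ⟨φ, hφ, by rw [hφa, hφ₀]⟩
  by_cases hbn : b + 1 < n
  · have hne : point a ha ≠ point (b + 1) hbn := fun h => by
      have : a = b + 1 := congrArg pos h
      omega
    have hne' : point b hb ≠ point (b + 1) hbn := fun h => by
      have : b = b + 1 := congrArg pos h
      omega
    have hor : ¬ R (b + 1) ∨ K (b + 1) := by
      by_contra! hcon
      exact hmax ⟨by omega, hbn, hcon.1, hcon.2⟩
    have hsub : segment n a b ⊆ segment n a (b + 1) := fun x hx => ⟨hx.1, hx.2.trans b.le_succ⟩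
    have hmem : point b hb ∈ segment n a (b + 1) := ⟨hab, b.le_succ⟩
    have hmem' : point (b + 1) hbn ∈ segment n a (b + 1) := ⟨Nat.le_succ_of_le hab, le_rfl⟩
    rcases Nat.even_or_odd b with hev | hodd
    · have hle : point b hb ≤ point (b + 1) hbn := Or.inr ⟨hev, Or.inl rfl⟩
      have hnle : ¬ point (b + 1) hbn ≤ point b hb := fun h => hne' (le_antisymm hle h)
      -- The arrow leaves the segment, so any section continues and `R (b + 1)` cannot fail. Hence
      -- `K (b + 1)` holds, and its witness `t`, which dies at `b + 1`, is used in place of `s`.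
      rcases hor with hR | ⟨_, t, ht, hta, ht0⟩
      · refine absurd ⟨_, isSection_update hbn hs (transition M hle (s _)) (fun _ => rfl)
          (fun h => absurd h hnle), ?_⟩ hR
        rwa [Function.update_of_ne hne]
      · obtain ⟨φ, hφ, hφs⟩ := hbot t (ht.mono hsub) hta
        exact ⟨b, hab, hb, t, φ, ht.mono hsub, hφ, hφs,
          fun _ h => (ht h hmem hmem').trans ht0, fun _ h => absurd h hnle⟩
    · have hle : point (b + 1) hbn ≤ point b hb := Or.inr ⟨hodd.add_one, Or.inr rfl⟩
      have hnle : ¬ point b hb ≤ point (b + 1) hbn := fun h => hne' (le_antisymm h hle)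
      -- The arrow enters the segment. Failure of `R (b + 1)` means that sections ending in the
      -- range of the arrow vanish at `a`, so the cosection can be made zero on that range. `K (b +
      -- 1)` would imply `K b`.
      rcases hor with hR | ⟨_, t, ht, hta, ht0⟩
      · obtain ⟨φ₀, hφ₀⟩ := Module.Projective.exists_dual_eq_one 𝔽 hsa
        obtain ⟨φ, hφ, hφa, hφU⟩ := exists_isCosection_segment ha φ₀ hab hb
          (LinearMap.range (transition M hle)) (by
            rintro t ht ⟨u, hu⟩
            by_contra hta
            refine hR ⟨_, isSection_update hbn ht u (fun h => absurd h hnle) (fun _ => hu), ?_⟩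
            rw [Function.update_of_ne hne]
            exact fun h0 => hta (by rw [h0, map_zero]))
        exact ⟨b, hab, hb, s, φ, hs, hφ, by rw [hφa, hφ₀], fun _ h => absurd h hnle,
          fun _ h => LinearMap.ext fun u => hφU _ ⟨u, rfl⟩⟩
      · refine absurd (hK' t (ht.mono hsub) ?_) hta
        rw [← ht hle hmem' hmem, ht0, map_zero]
  · obtain ⟨φ, hφ, hφs⟩ := hbot s hs hsa
    exact ⟨b, hab, hb, s, φ, hs, hφ, hφs, fun h => absurd h hbn, fun h => absurd h hbn⟩

/-- Starting at the leftmost nonzero space makes the left end of the segment harmless; at the right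
end the arrow out of the section, or into the cosection, is zero by the choice of the segment. -/
theorem hasIntervalBasis_zigzag (M : Zigzag n ⥤ FGModuleCat.{u} 𝔽) : HasIntervalBasis M := by
  classical
  induction hd : ∑ x, Module.finrank 𝔽 (M.obj x) using Nat.strong_induction_on generalizing M with
  | _ d ih =>
  by_cases hM : ∀ x, ∀ v : M.obj x, v = 0
  · refine ⟨0, Fin.elim0, fun i => Fin.elim0 i, fun i => Fin.elim0 i, fun i => Fin.elim0 i,
      fun p v => ⟨Fin.elim0, ⟨fun i => Fin.elim0 i, ?_⟩, fun _ _ => Subsingleton.elim _ _⟩⟩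
    rw [hM p v]
    exact Fin.sum_univ_zero _ |>.symm
  have hex : ∃ a, ∃ (ha : a < n) (v : M.obj (point a ha)), v ≠ 0 := by
    push Not at hM
    obtain ⟨x, v, hv⟩ := hM
    exact ⟨x.pos, x.pos_lt, v, hv⟩
  obtain ⟨ha, v, hv⟩ := Nat.find_spec hex
  have hlt : ∀ x : Zigzag n, x.pos < Nat.find hex → ∀ v : M.obj x, v = 0 := by
    intro x hx v
    by_contra hne
    exact Nat.find_min hex hx ⟨x.pos_lt, v, hne⟩
  -- From here on only the vanishing of all spaces to the left of `a` is needed.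
  generalize Nat.find hex = a at ha v hv hlt
  obtain ⟨b, hab, hb, s, φ, hs, hφ, hφs, hsb, hφb⟩ := exists_section_cosection_segment ha v hv
  have hpair : ∀ x ∈ segment n a b, φ x (s x) = 1 := by
    intro x hx
    have key : ∀ {p q : Zigzag n}, p ≤ q → p ∈ segment n a b → q ∈ segment n a b →
        φ p (s p) = φ q (s q) := by
      intro p q hpq hp hq
      rw [← hφ hpq hp hq, LinearMap.comp_apply, hs hpq hp hq]
    have hchain := segment_chain (x := point a ha) ⟨le_rfl, hab⟩ hx
    clear hx
    induction hchain with
    | refl => exact hφs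
    | tail _ h ih =>
      obtain ⟨hp, hq, h | h⟩ := h
      · rw [← key h hp hq, ih]
      · rw [key h hq hp, ih]
  have hadj : ∀ {p q : Zigzag n}, p ≤ q ∨ q ≤ p → p ∈ segment n a b → q ∉ segment n a b →
      q.pos < a ∨ p.pos = b ∧ q.pos = b + 1 := by
    intro p q hpq hp hq
    by_contra hcon
    apply hq
    have h1 := hp.1
    have h2 := hp.2
    constructor <;> rcases hpq with h | h <;> rcases le_def.1 h with rfl | ⟨-, h⟩ <;> omega
  have hker : ∀ ⦃p q : Zigzag n⦄ (h : p ≤ q) v,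
      (if p ∈ segment n a b then φ p else 0) v = 0 →
      (if q ∈ segment n a b then φ q else 0) (transition M h v) = 0 := by
    intro p q h v hv
    by_cases hq : q ∈ segment n a b
    · rw [if_pos hq]
      by_cases hp : p ∈ segment n a b
      · rw [if_pos hp, ← hφ h hp hq] at hv
        exact hv
      · rcases hadj (Or.inr h) hq hp with hlt' | ⟨hqb, hpb⟩
        · rw [hlt p hlt' v, map_zero, map_zero]
        · have hb' : b + 1 < n := hpb ▸ p.pos_lt
          obtain rfl : q = point b hb := ext_pos hqb
          obtain rfl : p = point (b + 1) hb' := ext_pos hpb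
          exact LinearMap.congr_fun (hφb hb' h) v
    · rw [if_neg hq]
      rfl
  have hfin : ∀ x, Module.finrank 𝔽 ((kernelModule M
      (fun p => if p ∈ segment n a b then φ p else 0) hker).obj x) ≤
      Module.finrank 𝔽 (M.obj x) := fun x => Submodule.finrank_le (LinearMap.ker _)
  refine HasIntervalBasis.of_kernelModule hker (segmentInterval ha hab)
    (fun p => if p ∈ segment n a b then s p else 0) ?_ ?_ ?_ ?_ (ih _ ?_ _ rfl)
  · intro p hp
    rw [mem_segmentInterval] at hp
    exact if_neg hp
  · intro p q h hp
    rw [mem_segmentInterval] at hp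
    rw [if_pos hp]
    by_cases hq : q ∈ segment n a b
    · rw [if_pos hq, hs h hp hq]
    · rw [if_neg hq]
      rcases hadj (Or.inl h) hp hq with hlt' | ⟨hpb, hqb⟩
      · exact hlt q hlt' _
      · have hb' : b + 1 < n := hqb ▸ q.pos_lt
        obtain rfl : p = point b hb := ext_pos hpb
        obtain rfl : q = point (b + 1) hb' := ext_pos hqb
        exact hsb hb' h
  · intro p hp
    rw [mem_segmentInterval] at hp
    exact if_neg hp
  · intro p hp
    rw [mem_segmentInterval] at hp
    rw [if_pos hp, if_pos hp]
    exact hpair p hp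
  · rw [← hd]
    -- The dimension drops strictly at `a`, where `s` pairs to `1` and so is not in the kernel.
    refine Finset.sum_lt_sum (fun x _ => hfin x) ⟨point a ha, Finset.mem_univ _, ?_⟩
    refine Submodule.finrank_lt (s := LinearMap.ker _) fun htop => ?_
    have hmem : point a ha ∈ segment n a b := ⟨le_rfl, hab⟩
    have := htop.ge (Submodule.mem_top (x := s (point a ha)))
    rw [LinearMap.mem_ker] at this
    beta_reduce at this
    rw [if_pos hmem, hφs] at this
    exact one_ne_zero this

end ZigzagRank

theorem mainTheorem1 {𝔽 : Type u} [Field 𝔽] (I : ZigzagRank.FinInterval (ℤ × ℤ))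
    (M : I.carrier ⥤ FGModuleCat.{u} 𝔽) :
    (∃ B, ZigzagRank.IsBarcode (ZigzagRank.boundaryModule I M) B) ∧
      ∀ B, ZigzagRank.IsBarcode (ZigzagRank.boundaryModule I M) B →
        ∀ p : I.carrier,
          ZigzagRank.generalizedRank M p = ZigzagRank.fullMultiplicity B := by
  refine ⟨(ZigzagRank.hasIntervalBasis_zigzag _).exists_isBarcode, fun B hB p => ?_⟩
  -- Connectedness of the interval moves the base point to `p 0`, where the comparison with the cap
  -- takes place.
  rw [ZigzagRank.generalizedRank_eq_of_chain M (I.chain p _),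
    ZigzagRank.generalizedRank_boundaryModule I M]
  exact ZigzagRank.generalizedRank_eq_fullMultiplicity hB ZigzagRank.Zigzag.chain _
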